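/- Let $\Gamma\leqslant\mathrm{SL}(2,\mathbb R)$ be a Fuchsian group of the first kind, i.e. a discrete subgroup such that the quotient $\Gamma\backslash\mathcal H^*$ of $\mathcal H^*=\mathcal H\cup\{\text{cusps of }\Gamma\}$ (with the usual horoball topology) is compact, and let $f$ be a modular form of integer weight $k$ on $\Gamma$: a holomorphic function on the upper half-plane $\mathcal H$, bounded at the cusps of $\Gamma$, with $f\left(\frac{a\tau+b}{c\tau+d}\right)=(c\tau+d)^kf(\tau)$ for all $\begin{pmatrix}a&b\\c&d\end{pmatrix}\in\Gamma$. Put $$B=kff''-(k+1)f'^2,\qquad P_k=\frac{\left(k^2f^2f'''-3k(k+2)ff'f''+2(k+1)(k+2)f'^3\right)^2}{B^3},$$ $$Q_k=\frac{f^2\left(k(k+1)ff''''-4(k+1)(k+3)f'f'''+3(k+2)(k+3)f''^2\right)}{B^2},$$ and let $\mathcal G_k$ be the group of point transformations $$\tilde\tau=\frac{a\tau+b}{c\tau+d},\qquad \tilde f=(c\tau+d)^kf,\qquad \begin{pmatrix}a&b\\c&d\end{pmatrix}\in\mathrm{GL}(2,\mathbb R).$$ Then $P_k$ and $Q_k$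 are differential invariants of $\mathcal G_k$ (on holomorphic functions on open subsets of $\mathbb C$). Unless $f$ is constant, $B$ does not vanish identically on $\mathcal H$ for the form $f$, so that $P_k$ and $Q_k$ are defined as meromorphic functions on $\mathcal H$. Moreover, there is an irreducible polynomial $\mathcal F\in\mathbb C[X,Y]$, depending on $f$, of positive degree in $Y$, such that $f$ satisfies the ODE $$\mathcal F(P_k,Q_k)=0$$ at all points of $\mathcal H$ where $B\ne0$; with denominators cleared, i.e. multiplied by $B^{3\deg_X\mathcal F+2\deg_Y\mathcal F}$, this is a polynomial ODE in $f,f',f'',f''',f''''$ which $f$ satisfies on all of $\mathcal H$ and which is $\mathcal G_k$-invariant: every element of $\mathcal G_k$ takes local holomorphic solutions to solutions. -/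

import Mathlib

open scoped MatrixGroups
open UpperHalfPlane

noncomputable section

/-! ### Fuchsian groups of the first kind -/

/-- A subgroup of `SL(2, ℝ)`, regarded as a subgroup of `GL(2, ℝ)`. -/
abbrev asGL (Γ : Subgroup SL(2, ℝ)) : Subgroup (GL (Fin 2) ℝ) :=
  Γ.map (Matrix.SpecialLinearGroup.mapGL ℝ)

/-- The extended upper half-plane `ℍ* = ℍ ∪ {cusps of Γ}`. -/
inductive ExtendedHalfPlane (Γ : Subgroup SL(2, ℝ)) : Type
  | point (z : ℍ) : ExtendedHalfPlane Γ
  | cusp (c : OnePoint ℝ) (hc : IsCusp c (asGL Γ)) : ExtendedHalfPlane Γ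

namespace ExtendedHalfPlane

variable {Γ : Subgroup SL(2, ℝ)}

/-- The horoball topology on `ℍ*`: a set is open if its trace on `ℍ` is open and if, together with
a cusp `σ ∞` (`σ ∈ SL(2, ℝ)`), it contains a horoball `σ {Im z ≥ Y}` at that cusp. -/
instance : TopologicalSpace (ExtendedHalfPlane Γ) where
  IsOpen U := IsOpen {z : ℍ | point z ∈ U} ∧
    ∀ (c : OnePoint ℝ) (hc : IsCusp c (asGL Γ)), cusp c hc ∈ U →
      ∀ σ : SL(2, ℝ), Matrix.SpecialLinearGroup.mapGL ℝ σ • (OnePoint.infty : OnePoint ℝ) = c →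
        ∀ᶠ z in atImInfty, point (σ • z) ∈ U
  isOpen_univ := by simp
  isOpen_inter U V hU hV :=
    ⟨hU.1.inter hV.1, fun c hc h σ hσ => (hU.2 c hc h.1 σ hσ).and (hV.2 c hc h.2 σ hσ)⟩
  isOpen_sUnion S hS := by
    refine ⟨?_, ?_⟩
    · have : {z : ℍ | point z ∈ ⋃₀ S} = ⋃ U ∈ S, {z : ℍ | (point z : ExtendedHalfPlane Γ) ∈ U} := by
        ext z; simp
      rw [this]
      exact isOpen_biUnion fun U hU => (hS U hU).1
    · rintro c hc ⟨U, hU, hcU⟩ σ hσ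
      exact ((hS U hU).2 c hc hcU σ hσ).mono fun z hz => ⟨U, hU, hz⟩

/-- `Γ` acts on `ℍ*` by Möbius transformations. -/
instance : MulAction Γ (ExtendedHalfPlane Γ) where
  smul γ x := match x with
    | point z => point ((γ : SL(2, ℝ)) • z)
    | cusp c hc => cusp (Matrix.SpecialLinearGroup.mapGL ℝ (γ : SL(2, ℝ)) • c)
        (hc.smul_of_mem (Subgroup.mem_map_of_mem _ γ.2))
  one_smul x := by
    cases x with
    | point z => exact congrArg point (one_smul _ z)
    | cusp c hc =>
      change cusp _ _ = cusp _ _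
      simp
  mul_smul γ δ x := by
    cases x with
    | point z => exact congrArg point (mul_smul (γ : SL(2, ℝ)) (δ : SL(2, ℝ)) z)
    | cusp c hc =>
      change cusp _ _ = cusp _ _
      simp [mul_smul]

end ExtendedHalfPlane

/-- `Γ` is a Fuchsian group of the first kind: a discrete subgroup of `SL(2, ℝ)` whose
compactified quotient `Γ \ ℍ*` is indeed compact. -/
structure IsFuchsianFirstKind (Γ : Subgroup SL(2, ℝ)) : Prop where
  discrete : DiscreteTopology Γ
  compact : CompactSpace (Quotient (MulAction.orbitRel Γ (ExtendedHalfPlane Γ)))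

/-! ### Jets and the differential invariants `P_k`, `Q_k` -/

/-- The 4-jet `(g, g', g'', g''', g'''')` of `g` at `τ`. -/
def jet (g : ℂ → ℂ) (τ : ℂ) : Fin 5 → ℂ := fun i => iteratedDeriv i g τ

/-- `k f f'' - (k+1) f'²`. -/
def formB (k : ℤ) (y : Fin 5 → ℂ) : ℂ := k * y 0 * y 2 - (k + 1) * y 1 ^ 2

/-- `k² f² f''' - 3k(k+2) f f' f'' + 2(k+1)(k+2) f'³`. -/
def formA (k : ℤ) (y : Fin 5 → ℂ) : ℂ :=
  k ^ 2 * y 0 ^ 2 * y 3 - 3 * k * (k + 2) * y 0 * y 1 * y 2 + 2 * (k + 1) * (k + 2) * y 1 ^ 3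

/-- `k(k+1) f f'''' - 4(k+1)(k+3) f' f''' + 3(k+2)(k+3) f''²`. -/
def formD (k : ℤ) (y : Fin 5 → ℂ) : ℂ :=
  k * (k + 1) * y 0 * y 4 - 4 * (k + 1) * (k + 3) * y 1 * y 3 + 3 * (k + 2) * (k + 3) * y 2 ^ 2

/-- The third-order invariant `P_k` as a function on jets. It has the same number of derivatives
in numerator and denominator, so it does not matter whether the prime is `d/dτ` or
`(2πi)⁻¹ d/dτ`; the same holds for `Q_k`. -/
def invP (k : ℤ) (y : Fin 5 → ℂ) : ℂ := formA k y ^ 2 / formB k y ^ 3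

/-- The fourth-order invariant `Q_k` as a function on jets. -/
def invQ (k : ℤ) (y : Fin 5 → ℂ) : ℂ := y 0 ^ 2 * formD k y / formB k y ^ 2

/-- The left-hand side of the ODE `𝓕(P_k, Q_k) = 0` after multiplication by the power
`B ^ (3 deg_X 𝓕 + 2 deg_Y 𝓕)` of the denominator `B = k f f'' - (k+1) f'²`: a polynomial in
`f, f', f'', f''', f''''`. See `clearedODE_eq`. -/
def clearedODE (k : ℤ) (F : MvPolynomial (Fin 2) ℂ) (y : Fin 5 → ℂ) : ℂ :=
  ∑ m ∈ F.support, F.coeff m * (formA k y ^ 2) ^ m 0 * (y 0 ^ 2 * formD k y) ^ m 1 *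
    formB k y ^ (3 * (F.degreeOf 0 - m 0) + 2 * (F.degreeOf 1 - m 1))

lemma clearedODE_eq (k : ℤ) (F : MvPolynomial (Fin 2) ℂ) (y : Fin 5 → ℂ) (hy : formB k y ≠ 0) :
    clearedODE k F y = formB k y ^ (3 * F.degreeOf 0 + 2 * F.degreeOf 1) *
      MvPolynomial.eval ![invP k y, invQ k y] F := by
  rw [clearedODE, MvPolynomial.eval_eq', Finset.mul_sum]
  refine Finset.sum_congr rfl fun m hm => ?_
  obtain ⟨a, ha⟩ := Nat.exists_eq_add_of_le (MvPolynomial.monomial_le_degreeOf 0 hm)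
  obtain ⟨b, hb⟩ := Nat.exists_eq_add_of_le (MvPolynomial.monomial_le_degreeOf 1 hm)
  rw [ha, hb, Fin.prod_univ_two]
  simp only [Nat.add_sub_cancel_left, invP, invQ, Matrix.cons_val_zero, Matrix.cons_val_one,
    div_pow]
  have e : 3 * (m 0 + a) + 2 * (m 1 + b) = (3 * a + 2 * b) + 3 * m 0 + 2 * m 1 := by ring
  have e' : formB k y ^ (3 * a + 2 * b + 3 * m 0 + 2 * m 1) =
      formB k y ^ (3 * a + 2 * b) * (formB k y ^ 3) ^ m 0 * (formB k y ^ 2) ^ m 1 := by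
    rw [← pow_mul, ← pow_mul, ← pow_add, ← pow_add]
  rw [e, e']
  field_simp

/-! ### The group `𝒢_k` -/

/-- The function `h` is the transform of `g`, defined on `U`, under the element of `𝒢_k` given by
`γ = (a b; c d)`: the point transformation `τ ↦ (aτ+b)/(cτ+d)`, `f ↦ (cτ+d)^k f` is defined over
`U` and maps the graph of `g` over `U` into the graph of `h`. -/
def IsTransform (k : ℤ) (γ : GL (Fin 2) ℝ) (U : Set ℂ) (g h : ℂ → ℂ) : Prop :=
  ∀ τ ∈ U, (γ 1 0 : ℂ) * τ + γ 1 1 ≠ 0 ∧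
    h ((γ 0 0 * τ + γ 0 1) / (γ 1 0 * τ + γ 1 1)) = ((γ 1 0 : ℂ) * τ + γ 1 1) ^ k * g τ

/-- A function `I` on jets is a differential invariant of `𝒢_k`. -/
def IsDifferentialInvariant (k : ℤ) (I : (Fin 5 → ℂ) → ℂ) : Prop :=
  ∀ (γ : GL (Fin 2) ℝ) (U : Set ℂ) (g h : ℂ → ℂ), IsOpen U → DifferentiableOn ℂ g U →
    IsTransform k γ U g h →
    ∀ τ ∈ U, I (jet h ((γ 0 0 * τ + γ 0 1) / (γ 1 0 * τ + γ 1 1))) = I (jet g τ)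

/-- `g` solves the ODE `E(g, g', g'', g''', g'''') = 0` on `U`. -/
def SolvesODE (E : (Fin 5 → ℂ) → ℂ) (U : Set ℂ) (g : ℂ → ℂ) : Prop :=
  ∀ τ ∈ U, E (jet g τ) = 0

/-- The ODE `E(f, f', f'', f''', f'''') = 0` is invariant under `𝒢_k`: the group maps (local,
holomorphic) solutions to solutions. -/
def IsInvariantODE (k : ℤ) (E : (Fin 5 → ℂ) → ℂ) : Prop :=
  ∀ (γ : GL (Fin 2) ℝ) (U : Set ℂ) (g h : ℂ → ℂ), IsOpen U → DifferentiableOn ℂ g U →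
    IsTransform k γ U g h → SolvesODE E U g →
    SolvesODE E ((fun τ : ℂ => (γ 0 0 * τ + γ 0 1) / (γ 1 0 * τ + γ 1 1)) '' U) h

end

/-! Differentiating the transformation law four times shows that `B`, `A`, `D` (that is, `formB`,
`formA`, `formD`) are relative invariants: the inhomogeneous terms cancel. With `L = J^(2k+4)/e²`,
where `J = cτ+d` and `e = det γ`, `B` is multiplied by `L`, `A²` by `L³` and `f²D` by `L²`. This
makes `P_k`, `Q_k` invariant and every cleared ODE homogeneous. For a modular form `f`, it makes
`B`, `A`, `D` modular forms of weights `2k+4`, `3k+6`, `2k+8`.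

The relation comes from counting. The `(N+1)²` products `B^(5N) P^i Q^j`, `0 ≤ i, j ≤ N`, are forms
of one weight proportional to `N`, while forms of weight `2v` span a space of dimension `O(v)`
(`IsFuchsianFirstKind.exists_linear_relation`). That bound is proved without Riemann-Roch.
Compactness gives finitely many discs and horoballs meeting every orbit. If `O(v)` Taylor
coefficients of a form vanish at the centre of each, Schwarz's lemma bounds its invariant norm there
by half the global supremum, which is therefore zero.

Holomorphic functions on `ℍ` form a domain, so the relations form a nonzero prime ideal, which
contains a prime element. If this element does not involve `Y`, then `P_k` is constant.
Differentiating `A² = r B³` then makes `Q_k` a constant `q`, and `Y - q` serves instead.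

Finally, `B ≡ 0` leaves only constants and `C (τ+b)^(-k)` when `k > 0`. The latter is excluded
because its reciprocal would be a nonzero form of negative weight; the maximum principle rules these
out. Forms of weight zero are constant by the linear relation between their powers. -/

/-! ### Jets under point transformations and relative invariants -/

/-- If `H` composed with a Möbius transformation is `G`, then the derivative of `H` is given by
the chain rule. -/
lemma hasDerivAt_of_comp_moebius (γ : GL (Fin 2) ℝ) {U : Set ℂ} (hU : IsOpen U) {H G : ℂ → ℂ}
    {G' τ : ℂ} (hτ : τ ∈ U) (hden : ∀ z ∈ U, (γ 1 0 : ℂ) * z + γ 1 1 ≠ 0)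
    (hH : ∀ z ∈ U, H ((γ 0 0 * z + γ 0 1) / (γ 1 0 * z + γ 1 1)) = G z)
    (hG : HasDerivAt G G' τ) :
    HasDerivAt H (((γ 1 0 : ℂ) * τ + γ 1 1) ^ 2 / (γ.det.val : ℂ) * G')
      ((γ 0 0 * τ + γ 0 1) / (γ 1 0 * τ + γ 1 1)) := by
  have hdet : ((γ.det.val : ℝ) : ℂ) = γ 0 0 * γ 1 1 - γ 0 1 * γ 1 0 := by
    rw [Matrix.GeneralLinearGroup.val_det_apply, Matrix.det_fin_two]; push_cast; rfl
  have hδ : (γ 0 0 : ℂ) * γ 1 1 - γ 0 1 * γ 1 0 ≠ 0 := by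
    rw [← hdet]; exact_mod_cast γ.det.ne_zero
  rw [hdet]
  generalize (γ 0 0 : ℂ) = a at *
  generalize (γ 0 1 : ℂ) = b at *
  generalize (γ 1 0 : ℂ) = c at *
  generalize (γ 1 1 : ℂ) = d at *
  have hj := hden τ hτ
  set w₀ := (a * τ + b) / (c * τ + d) with hw₀
  have hwJ : w₀ * (c * τ + d) = a * τ + b := div_mul_cancel₀ _ hj
  have e₁ : a - c * w₀ = (a * d - b * c) / (c * τ + d) := by
    rw [eq_div_iff hj]; linear_combination -c * hwJ
  have e₂ : d * w₀ - b = (a * d - b * c) * τ / (c * τ + d) := by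
    rw [eq_div_iff hj]; linear_combination d * hwJ
  have hw : a - c * w₀ ≠ 0 := by
    rw [e₁]; exact div_ne_zero hδ hj
  -- The inverse Möbius map: near `w₀` the function `H` is `G ∘ ν`, so the chain rule applies.
  set ν : ℂ → ℂ := fun w => (d * w - b) / (a - c * w) with hν
  have hνw : ν w₀ = τ := by
    simp only [hν]; rw [e₁, e₂]; field_simp
  have hνd : HasDerivAt ν ((c * τ + d) ^ 2 / (a * d - b * c)) w₀ := by
    have h1 : HasDerivAt (fun w : ℂ => d * w - b) d w₀ := by
      simpa using ((hasDerivAt_id w₀).const_mul d).sub_const b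
    have h2 : HasDerivAt (fun w : ℂ => a - c * w) (-c) w₀ := by
      simpa using ((hasDerivAt_id w₀).const_mul c).const_sub a
    convert! h1.div h2 hw using 1
    rw [e₁, e₂]; field_simp; ring
  have hcomp : HasDerivAt (G ∘ ν) (G' * ((c * τ + d) ^ 2 / (a * d - b * c))) w₀ :=
    HasDerivAt.comp w₀ (by rwa [hνw]) hνd
  rw [mul_comm]
  refine hcomp.congr_of_eventuallyEq ?_
  have e1 : ∀ᶠ w in nhds w₀, ν w ∈ U :=
    hνd.continuousAt.eventually_mem (hU.mem_nhds (by rwa [hνw]))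
  have e2 : ∀ᶠ w in nhds w₀, a - c * w ≠ 0 :=
    (by fun_prop : ContinuousAt (fun w : ℂ => a - c * w) w₀).eventually_ne hw
  filter_upwards [e1, e2] with w hwU hw2
  rw [Function.comp_apply, ← hH _ hwU]
  congr 1
  have hνJ : ν w * (a - c * w) = d * w - b := div_mul_cancel₀ _ hw2
  have h1 : a * ν w + b = (a * d - b * c) * w / (a - c * w) := by
    rw [eq_div_iff hw2]; linear_combination a * hνJ
  have h2 : c * ν w + d = (a * d - b * c) / (a - c * w) := by
    rw [eq_div_iff hw2]; linear_combination c * hνJ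
  rw [h1, h2, div_div_div_cancel_right₀ hw2, mul_div_cancel_left₀ _ hδ]

lemma hasDerivAt_iteratedDeriv {g : ℂ → ℂ} {U : Set ℂ} (hU : IsOpen U)
    (hg : DifferentiableOn ℂ g U) (n : ℕ) {τ : ℂ} (hτ : τ ∈ U) :
    HasDerivAt (iteratedDeriv n g) (iteratedDeriv (n + 1) g τ) τ := by
  rw [iteratedDeriv_succ]
  have : AnalyticAt ℂ (iteratedDeriv n g) τ := by
    rw [iteratedDeriv_eq_iterate]
    exact ((hg.analyticAt (hU.mem_nhds hτ)).iterated_deriv n)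
  exact this.differentiableAt.hasDerivAt

/-- One step in the computation of the jet of a transform. -/
lemma iteratedDeriv_succ_transform (k : ℤ) (γ : GL (Fin 2) ℝ) {U : Set ℂ} (hU : IsOpen U)
    {h : ℂ → ℂ} {R R' : ℂ → ℂ} (n : ℕ) (hden : ∀ z ∈ U, (γ 1 0 : ℂ) * z + γ 1 1 ≠ 0)
    (hH : ∀ z ∈ U, iteratedDeriv n h ((γ 0 0 * z + γ 0 1) / (γ 1 0 * z + γ 1 1)) =
      ((γ 1 0 : ℂ) * z + γ 1 1) ^ k * R z)
    (hR : ∀ z ∈ U, HasDerivAt R (R' z) z) :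
    ∀ z ∈ U, iteratedDeriv (n + 1) h ((γ 0 0 * z + γ 0 1) / (γ 1 0 * z + γ 1 1)) =
      ((γ 1 0 : ℂ) * z + γ 1 1) ^ k * (((γ 1 0 : ℂ) * z + γ 1 1) *
        (k * γ 1 0 * R z + ((γ 1 0 : ℂ) * z + γ 1 1) * R' z) / (γ.det.val : ℂ)) := by
  intro z hz
  have hj := hden z hz
  have h1 : HasDerivAt (fun z : ℂ => (γ 1 0 : ℂ) * z + γ 1 1) (γ 1 0) z := by
    simpa using ((hasDerivAt_id z).const_mul (γ 1 0 : ℂ)).add_const (γ 1 1 : ℂ)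
  have h2 := (hasDerivAt_zpow k _ (Or.inl hj)).comp z h1
  have h3 := hasDerivAt_of_comp_moebius γ hU hz hden hH (h2.mul (hR z hz))
  rw [iteratedDeriv_succ, h3.deriv]
  simp only [Function.comp]
  rw [zpow_sub_one₀ hj]
  field_simp

lemma hasDerivAt_linear_pow (c d : ℂ) (n : ℕ) (z : ℂ) :
    HasDerivAt (fun z : ℂ => (c * z + d) ^ n) (n * (c * z + d) ^ (n - 1) * c) z := by
  have h1 : HasDerivAt (fun z : ℂ => c * z + d) c z := by
    simpa using ((hasDerivAt_id z).const_mul c).add_const d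
  exact h1.pow n

/-- The 4-jet of a transform of `g` under an element of `𝒢_k`. -/
lemma jet_of_isTransform {k : ℤ} {γ : GL (Fin 2) ℝ} {U : Set ℂ} {g h : ℂ → ℂ} (hU : IsOpen U)
    (hg : DifferentiableOn ℂ g U) (H : IsTransform k γ U g h) {τ : ℂ} (hτ : τ ∈ U) :
    ∃ J e : ℂ, J = (γ 1 0 : ℂ) * τ + γ 1 1 ∧ e = (γ.det.val : ℂ) ∧
    jet h ((γ 0 0 * τ + γ 0 1) / (γ 1 0 * τ + γ 1 1)) = fun i => J ^ k *
      ![jet g τ 0,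
        (J ^ 2 * jet g τ 1 + k * γ 1 0 * J * jet g τ 0) / e,
        (J ^ 4 * jet g τ 2 + 2 * (k + 1) * γ 1 0 * J ^ 3 * jet g τ 1 +
          k * (k + 1) * γ 1 0 ^ 2 * J ^ 2 * jet g τ 0) / e ^ 2,
        (J ^ 6 * jet g τ 3 + 3 * (k + 2) * γ 1 0 * J ^ 5 * jet g τ 2 +
          3 * (k + 1) * (k + 2) * γ 1 0 ^ 2 * J ^ 4 * jet g τ 1 +
          k * (k + 1) * (k + 2) * γ 1 0 ^ 3 * J ^ 3 * jet g τ 0) / e ^ 3,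
        (J ^ 8 * jet g τ 4 + 4 * (k + 3) * γ 1 0 * J ^ 7 * jet g τ 3 +
          6 * (k + 2) * (k + 3) * γ 1 0 ^ 2 * J ^ 6 * jet g τ 2 +
          4 * (k + 1) * (k + 2) * (k + 3) * γ 1 0 ^ 3 * J ^ 5 * jet g τ 1 +
          k * (k + 1) * (k + 2) * (k + 3) * γ 1 0 ^ 4 * J ^ 4 * jet g τ 0) / e ^ 4] i := by
  refine ⟨_, _, rfl, rfl, ?_⟩
  have hden : ∀ z ∈ U, (γ 1 0 : ℂ) * z + γ 1 1 ≠ 0 := fun z hz => (H z hz).1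
  have hδ : (γ.det.val : ℂ) ≠ 0 := by exact_mod_cast γ.det.ne_zero
  have D : ∀ n, ∀ z ∈ U, HasDerivAt (iteratedDeriv n g) (iteratedDeriv (n + 1) g z) z :=
    fun n z hz => hasDerivAt_iteratedDeriv hU hg n hz
  have J : ∀ n : ℕ, ∀ z ∈ U, HasDerivAt (fun z : ℂ => ((γ 1 0 : ℂ) * z + γ 1 1) ^ n)
    (n * ((γ 1 0 : ℂ) * z + γ 1 1) ^ (n - 1) * γ 1 0) z :=
    fun n z _ => hasDerivAt_linear_pow _ _ n z
  have s0 : ∀ z ∈ U, iteratedDeriv 0 h ((γ 0 0 * z + γ 0 1) / (γ 1 0 * z + γ 1 1)) =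
      ((γ 1 0 : ℂ) * z + γ 1 1) ^ k * iteratedDeriv 0 g z := by
    intro z hz
    simpa using (H z hz).2
  have s1 := iteratedDeriv_succ_transform k γ hU 0 hden s0 (D 0)
  -- Each derivative is regrouped into terms `J ^ m * g⁽ⁿ⁾`, so that the product rule applies
  -- termwise at the next order. The factor `J ^ k` stays outside because `k` may be negative.
  have s1' : ∀ z ∈ U, iteratedDeriv 1 h ((γ 0 0 * z + γ 0 1) / (γ 1 0 * z + γ 1 1)) =
      ((γ 1 0 : ℂ) * z + γ 1 1) ^ k * (((((γ 1 0 : ℂ) * z + γ 1 1) ^ 2 * iteratedDeriv 1 g z +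
        k * γ 1 0 * (((γ 1 0 : ℂ) * z + γ 1 1) ^ 1 * iteratedDeriv 0 g z))) / (γ.det.val : ℂ)) := by
    intro z hz
    rw [s1 z hz]; ring
  have s2 := iteratedDeriv_succ_transform k γ hU 1 hden s1' fun z hz =>
    (((J 2 z hz).mul (D 1 z hz)).add (((J 1 z hz).mul (D 0 z hz)).const_mul _)).div_const _
  have s2' : ∀ z ∈ U, iteratedDeriv 2 h ((γ 0 0 * z + γ 0 1) / (γ 1 0 * z + γ 1 1)) =
      ((γ 1 0 : ℂ) * z + γ 1 1) ^ k * ((((γ 1 0 : ℂ) * z + γ 1 1) ^ 4 * iteratedDeriv 2 g z +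
        2 * (k + 1) * γ 1 0 * (((γ 1 0 : ℂ) * z + γ 1 1) ^ 3 * iteratedDeriv 1 g z) +
        k * (k + 1) * γ 1 0 ^ 2 * (((γ 1 0 : ℂ) * z + γ 1 1) ^ 2 * iteratedDeriv 0 g z)) /
        (γ.det.val : ℂ) ^ 2) := by
    intro z hz
    rw [s2 z hz]; push_cast; field_simp; ring
  have s3 := iteratedDeriv_succ_transform k γ hU 2 hden s2' fun z hz =>
    ((((J 4 z hz).mul (D 2 z hz)).add (((J 3 z hz).mul (D 1 z hz)).const_mul _)).add
      (((J 2 z hz).mul (D 0 z hz)).const_mul _)).div_const _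
  have s3' : ∀ z ∈ U, iteratedDeriv 3 h ((γ 0 0 * z + γ 0 1) / (γ 1 0 * z + γ 1 1)) =
      ((γ 1 0 : ℂ) * z + γ 1 1) ^ k * ((((γ 1 0 : ℂ) * z + γ 1 1) ^ 6 * iteratedDeriv 3 g z +
        3 * (k + 2) * γ 1 0 * (((γ 1 0 : ℂ) * z + γ 1 1) ^ 5 * iteratedDeriv 2 g z) +
        3 * (k + 1) * (k + 2) * γ 1 0 ^ 2 *
          (((γ 1 0 : ℂ) * z + γ 1 1) ^ 4 * iteratedDeriv 1 g z) +
        k * (k + 1) * (k + 2) * γ 1 0 ^ 3 *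
          (((γ 1 0 : ℂ) * z + γ 1 1) ^ 3 * iteratedDeriv 0 g z)) / (γ.det.val : ℂ) ^ 3) := by
    intro z hz
    rw [s3 z hz]; push_cast; field_simp; ring
  have s4 := iteratedDeriv_succ_transform k γ hU 3 hden s3' fun z hz =>
    (((((J 6 z hz).mul (D 3 z hz)).add (((J 5 z hz).mul (D 2 z hz)).const_mul _)).add
      (((J 4 z hz).mul (D 1 z hz)).const_mul _)).add
      (((J 3 z hz).mul (D 0 z hz)).const_mul _)).div_const _
  funext i
  fin_cases i
  · exact s0 τ hτ
  · simp only [jet]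
    refine (s1' τ hτ).trans (congrArg _ ?_)
    simp; try ring
  · simp only [jet]
    refine (s2' τ hτ).trans (congrArg _ ?_)
    simp; try ring
  · simp only [jet]
    refine (s3' τ hτ).trans (congrArg _ ?_)
    simp; try ring
  · simp only [jet]
    refine (s4 τ hτ).trans (congrArg _ ?_)
    simp; field_simp; ring

section Covariance

variable {k : ℤ} {γ : GL (Fin 2) ℝ} {U : Set ℂ} {g h : ℂ → ℂ}

/-- `B`, `A` and `D` are relative invariants. -/
lemma form_of_isTransform (hU : IsOpen U) (hg : DifferentiableOn ℂ g U)
    (H : IsTransform k γ U g h) {τ : ℂ} (hτ : τ ∈ U) {w : ℂ}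
    (hw : w = (γ 0 0 * τ + γ 0 1) / (γ 1 0 * τ + γ 1 1)) {J e : ℂ}
    (hJ : J = (γ 1 0 : ℂ) * τ + γ 1 1) (he : e = (γ.det.val : ℂ)) :
    jet h w 0 = J ^ k * jet g τ 0 ∧
    formB k (jet h w) = (J ^ k) ^ 2 * J ^ 4 / e ^ 2 * formB k (jet g τ) ∧
    formA k (jet h w) = (J ^ k) ^ 3 * J ^ 6 / e ^ 3 * formA k (jet g τ) ∧
    formD k (jet h w) = (J ^ k) ^ 2 * J ^ 8 / e ^ 4 * formD k (jet g τ) := by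
  obtain ⟨J, e, rfl, rfl, hjet⟩ := jet_of_isTransform hU hg H hτ
  have hδ : (γ.det.val : ℂ) ≠ 0 := by exact_mod_cast γ.det.ne_zero
  subst hw hJ he
  rw [hjet]
  -- With `J ^ k` replaced by a free symbol, the covariances become rational identities in which all
  -- terms containing `c` cancel.
  generalize ((γ 1 0 : ℂ) * τ + γ 1 1) ^ k = p
  generalize (γ 1 0 : ℂ) * τ + γ 1 1 = J
  generalize (γ.det.val : ℂ) = e at *
  generalize (γ 1 0 : ℂ) = c
  generalize jet g τ = y
  refine ⟨by simp, ?_, ?_, ?_⟩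
  · simp [formB]; field_simp; ring
  · simp [formA]; field_simp; ring
  · simp [formD]; field_simp; ring

end Covariance

/-- Numerator and denominator are multiplied by the same nonzero factor. Where `B` vanishes both
values are `0` by the convention for division. -/
theorem isDifferentialInvariant_invP (k : ℤ) : IsDifferentialInvariant k (invP k) := by
  intro γ U g h hU hg H τ hτ
  obtain ⟨-, hB, hA, -⟩ := form_of_isTransform hU hg H hτ rfl rfl rfl
  have hδ : (γ.det.val : ℂ) ≠ 0 := by exact_mod_cast γ.det.ne_zero
  have hj := (H τ hτ).1
  have hjk := zpow_ne_zero k hj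
  rw [invP, invP, hB, hA]
  generalize ((γ 1 0 : ℂ) * τ + γ 1 1) ^ k = p at *
  generalize (γ 1 0 : ℂ) * τ + γ 1 1 = J at *
  rw [mul_pow, mul_pow]
  have : ((p ^ 3 * J ^ 6 / (γ.det.val : ℂ) ^ 3) ^ 2) = (p ^ 2 * J ^ 4 / (γ.det.val : ℂ) ^ 2) ^ 3 := by
    field_simp
  rw [this, mul_div_mul_left]
  positivity

theorem isDifferentialInvariant_invQ (k : ℤ) : IsDifferentialInvariant k (invQ k) := by
  intro γ U g h hU hg H τ hτ
  obtain ⟨h0, hB, -, hD⟩ := form_of_isTransform hU hg H hτ rfl rfl rfl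
  have hδ : (γ.det.val : ℂ) ≠ 0 := by exact_mod_cast γ.det.ne_zero
  have hj := (H τ hτ).1
  have hjk := zpow_ne_zero k hj
  rw [invQ, invQ, h0, hB, hD]
  generalize ((γ 1 0 : ℂ) * τ + γ 1 1) ^ k = p at *
  generalize (γ 1 0 : ℂ) * τ + γ 1 1 = J at *
  have : (p * jet g τ 0) ^ 2 * (p ^ 2 * J ^ 8 / (γ.det.val : ℂ) ^ 4 * formD k (jet g τ)) =
      (p ^ 2 * J ^ 4 / (γ.det.val : ℂ) ^ 2) ^ 2 * (jet g τ 0 ^ 2 * formD k (jet g τ)) := by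
    field_simp
  rw [this, mul_pow _ (formB k _), mul_div_mul_left]
  positivity

/-- Every summand is multiplied by the same power `L ^ (3 deg_X + 2 deg_Y)`, so the equation is
homogeneous. -/
theorem isInvariantODE_clearedODE (k : ℤ) (F : MvPolynomial (Fin 2) ℂ) :
    IsInvariantODE k (clearedODE k F) := by
  rintro γ U g h hU hg H hsol _ ⟨τ, hτ, rfl⟩
  obtain ⟨h0, hB, hA, hD⟩ := form_of_isTransform hU hg H hτ rfl rfl rfl
  have key := hsol τ hτ
  simp only [clearedODE] at key ⊢
  rw [h0, hB, hA, hD]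
  generalize ((γ 1 0 : ℂ) * τ + γ 1 1) ^ k = p at *
  generalize (γ 1 0 : ℂ) * τ + γ 1 1 = J at *
  rw [← mul_zero ((p ^ 2 * J ^ 4 / (γ.det.val : ℂ) ^ 2) ^ (3 * F.degreeOf 0 + 2 * F.degreeOf 1)),
    ← key, Finset.mul_sum]
  refine Finset.sum_congr rfl fun m hm => ?_
  have hδ : (γ.det.val : ℂ) ≠ 0 := by exact_mod_cast γ.det.ne_zero
  obtain ⟨a, ha⟩ := Nat.exists_eq_add_of_le (MvPolynomial.monomial_le_degreeOf 0 hm)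
  obtain ⟨b, hb⟩ := Nat.exists_eq_add_of_le (MvPolynomial.monomial_le_degreeOf 1 hm)
  have e1 : (p ^ 3 * J ^ 6 / (γ.det.val : ℂ) ^ 3 * formA k (jet g τ)) ^ 2 =
      (p ^ 2 * J ^ 4 / (γ.det.val : ℂ) ^ 2) ^ 3 * formA k (jet g τ) ^ 2 := by
    field_simp
  have e2 : (p * jet g τ 0) ^ 2 * (p ^ 2 * J ^ 8 / (γ.det.val : ℂ) ^ 4 * formD k (jet g τ)) =
      (p ^ 2 * J ^ 4 / (γ.det.val : ℂ) ^ 2) ^ 2 * (jet g τ 0 ^ 2 * formD k (jet g τ)) := by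
    field_simp
  rw [e1, e2, ha, hb]
  generalize p ^ 2 * J ^ 4 / (γ.det.val : ℂ) ^ 2 = L
  simp only [Nat.add_sub_cancel_left]
  ring

open Matrix.SpecialLinearGroup (mapGL)
open scoped ModularForm Manifold Topology

/-! ### Slash action of `SL(2, ℝ)` -/

lemma coe_mapGL_smul (σ : SL(2, ℝ)) (z : ℍ) : mapGL ℝ σ • z = σ • z := rfl

lemma slash_mapGL_apply (w : ℤ) (F : ℍ → ℂ) (σ : SL(2, ℝ)) (z : ℍ) :
    (F ∣[w] mapGL ℝ σ) z = F (σ • z) * denom (mapGL ℝ σ) z ^ (-w) := by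
  rw [ModularForm.slash_apply, UpperHalfPlane.σ]
  simp [coe_mapGL_smul]

lemma im_SL_smul (σ : SL(2, ℝ)) (z : ℍ) :
    (σ • z).im = z.im / ‖denom (mapGL ℝ σ) z‖ ^ 2 := by
  have := UpperHalfPlane.im_smul_eq_div_normSq (mapGL ℝ σ) z
  rw [coe_mapGL_smul] at this
  rw [this, Complex.normSq_eq_norm_sq]
  simp

lemma mul_slash_mapGL (w₁ w₂ : ℤ) (F G : ℍ → ℂ) (σ : SL(2, ℝ)) :
    (F * G) ∣[w₁ + w₂] mapGL ℝ σ = F ∣[w₁] mapGL ℝ σ * G ∣[w₂] mapGL ℝ σ := by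
  simp [ModularForm.mul_slash]

lemma smul_slash_mapGL (w : ℤ) (F : ℍ → ℂ) (c : ℂ) (σ : SL(2, ℝ)) :
    (c • F) ∣[w] mapGL ℝ σ = c • F ∣[w] mapGL ℝ σ := by
  simp [ModularForm.smul_slash, UpperHalfPlane.σ]

/-- A holomorphic function on `ℍ` is a modular form of weight `w` on `Γ`. -/
structure IsForm (Γ : Subgroup SL(2, ℝ)) (w : ℤ) (F : ℍ → ℂ) : Prop where
  slash_eq : ∀ γ ∈ Γ, F ∣[w] mapGL ℝ γ = F
  mdiff : MDiff F
  bdd : ∀ σ : SL(2, ℝ), IsCusp (mapGL ℝ σ • (OnePoint.infty : OnePoint ℝ)) (asGL Γ) →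
    IsBoundedAtImInfty (F ∣[w] mapGL ℝ σ)

lemma ModularForm.isForm {Γ : Subgroup SL(2, ℝ)} {k : ℤ} (f : ModularForm (asGL Γ) k) :
    IsForm Γ k f where
  slash_eq _ hγ := f.slash_action_eq' _ (Subgroup.mem_map_of_mem _ hγ)
  mdiff := f.holo'
  bdd _ hσ := f.bdd_at_cusps' hσ _ rfl

namespace IsForm

variable {Γ : Subgroup SL(2, ℝ)} {w w₁ w₂ : ℤ} {F G : ℍ → ℂ}

lemma mul (hF : IsForm Γ w₁ F) (hG : IsForm Γ w₂ G) : IsForm Γ (w₁ + w₂) (F * G) where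
  slash_eq γ hγ := by rw [mul_slash_mapGL, hF.slash_eq γ hγ, hG.slash_eq γ hγ]
  mdiff := hF.mdiff.mul hG.mdiff
  bdd σ hσ := by
    rw [mul_slash_mapGL]
    exact (hF.bdd σ hσ).mul (hG.bdd σ hσ)

lemma one : IsForm Γ 0 1 where
  slash_eq γ _ := by ext z; simp [slash_mapGL_apply]
  mdiff := mdifferentiable_const
  bdd σ _ := by
    have : (1 : ℍ → ℂ) ∣[(0 : ℤ)] mapGL ℝ σ = fun _ => 1 := by ext z; simp [slash_mapGL_apply]
    rw [this]
    exact Filter.const_boundedAtFilter _ _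

lemma pow (hF : IsForm Γ w F) (n : ℕ) : IsForm Γ (n * w) (F ^ n) := by
  induction n with
  | zero => simpa using one
  | succ n ih =>
    have := ih.mul hF
    rw [← pow_succ] at this
    convert! this using 1
    push_cast; ring

lemma smul (hF : IsForm Γ w F) (c : ℂ) : IsForm Γ w (c • F) where
  slash_eq γ hγ := by rw [smul_slash_mapGL, hF.slash_eq γ hγ]
  mdiff := hF.mdiff.const_smul c
  bdd σ hσ := by
    rw [smul_slash_mapGL]
    exact (hF.bdd σ hσ).smul c

lemma zero : IsForm Γ w 0 where
  slash_eq γ _ := SlashAction.zero_slash _ _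
  mdiff := mdifferentiable_const
  bdd σ _ := by
    rw [SlashAction.zero_slash]
    exact Filter.const_boundedAtFilter _ _

lemma add (hF : IsForm Γ w F) (hG : IsForm Γ w G) : IsForm Γ w (F + G) where
  slash_eq γ hγ := by rw [SlashAction.add_slash, hF.slash_eq γ hγ, hG.slash_eq γ hγ]
  mdiff := hF.mdiff.add hG.mdiff
  bdd σ hσ := by
    rw [SlashAction.add_slash]
    exact (hF.bdd σ hσ).add (hG.bdd σ hσ)

lemma sum {ι : Type*} (s : Finset ι) {F : ι → ℍ → ℂ} (hF : ∀ i ∈ s, IsForm Γ w (F i)) :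
    IsForm Γ w (∑ i ∈ s, F i) :=
  Finset.sum_induction _ _ (fun _ _ => add) zero hF

end IsForm

/-! ### Differential covariants of forms -/

lemma mdifferentiable_slash {F : ℍ → ℂ} (hF : MDiff F) (w : ℤ) (σ : SL(2, ℝ)) :
    MDiff (F ∣[w] mapGL ℝ σ) := hF.slash w _

/-- This reads the slash action as a point transformation carrying `F ∣ σ` to `F`, so that the jet
formulas apply to it. -/
lemma isTransform_slash (k : ℤ) (F : ℍ → ℂ) (σ : SL(2, ℝ)) :
    IsTransform k (mapGL ℝ σ) {z : ℂ | 0 < z.im} ((F ∣[k] mapGL ℝ σ) ∘ ofComplex)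
      (F ∘ ofComplex) := by
  intro z hz
  lift z to ℍ using hz
  have hd : denom (mapGL ℝ σ) z ≠ 0 := denom_ne_zero _ z
  refine ⟨hd, ?_⟩
  have e : ((mapGL ℝ σ 0 0 : ℝ) * (z : ℂ) + (mapGL ℝ σ 0 1 : ℝ)) /
      ((mapGL ℝ σ 1 0 : ℝ) * (z : ℂ) + (mapGL ℝ σ 1 1 : ℝ)) = ((σ • z : ℍ) : ℂ) := by
    rw [coe_specialLinearGroup_apply]; simp
  rw [e, Function.comp_apply, Function.comp_apply, ofComplex_apply, ofComplex_apply,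
    slash_mapGL_apply]
  change _ = denom (mapGL ℝ σ) z ^ k * _
  rw [mul_comm, mul_assoc, ← zpow_add₀ hd]
  simp

section Covariants

variable {Γ : Subgroup SL(2, ℝ)} {k : ℤ} {f : ℍ → ℂ}

/-- Here `σ` is arbitrary: `σ ∈ Γ` gives invariance of the covariants, and `σ` moving `∞` to a cusp
gives their boundedness there. -/
lemma slash_covariants (hf : MDiff f) (σ : SL(2, ℝ)) :
    (fun z : ℍ => formB k (jet (f ∘ ofComplex) z)) ∣[2 * k + 4] mapGL ℝ σ =
      (fun z : ℍ => formB k (jet ((f ∣[k] mapGL ℝ σ) ∘ ofComplex) z)) ∧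
    (fun z : ℍ => formA k (jet (f ∘ ofComplex) z)) ∣[3 * k + 6] mapGL ℝ σ =
      (fun z : ℍ => formA k (jet ((f ∣[k] mapGL ℝ σ) ∘ ofComplex) z)) ∧
    (fun z : ℍ => formD k (jet (f ∘ ofComplex) z)) ∣[2 * k + 8] mapGL ℝ σ =
      (fun z : ℍ => formD k (jet ((f ∣[k] mapGL ℝ σ) ∘ ofComplex) z)) := by
  have key := fun z : ℍ => form_of_isTransform isOpen_upperHalfPlaneSet
    (mdifferentiable_iff.mp (mdifferentiable_slash hf k σ)) (isTransform_slash k f σ)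
    (τ := z) z.im_pos (w := ((σ • z : ℍ) : ℂ)) (by rw [coe_specialLinearGroup_apply]; simp)
    rfl rfl
  have hd : ∀ z : ℍ, denom (mapGL ℝ σ) z ≠ 0 := fun z => denom_ne_zero _ z
  refine ⟨funext fun z => ?_, funext fun z => ?_, funext fun z => ?_⟩
  · rw [slash_mapGL_apply, (key z).2.1]
    change (denom (mapGL ℝ σ) z ^ k) ^ 2 * denom (mapGL ℝ σ) z ^ 4 / _ * _ * _ = _
    have : denom (mapGL ℝ σ) z ^ (-(2 * k + 4)) =
        ((denom (mapGL ℝ σ) z ^ k) ^ 2 * denom (mapGL ℝ σ) z ^ 4)⁻¹ := by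
      rw [zpow_neg, zpow_add₀ (hd z), mul_comm 2 k, zpow_mul]; norm_cast
    rw [this]
    have := zpow_ne_zero k (hd z)
    have := hd z
    simp
    field_simp
  · rw [slash_mapGL_apply, (key z).2.2.1]
    change (denom (mapGL ℝ σ) z ^ k) ^ 3 * denom (mapGL ℝ σ) z ^ 6 / _ * _ * _ = _
    have : denom (mapGL ℝ σ) z ^ (-(3 * k + 6)) =
        ((denom (mapGL ℝ σ) z ^ k) ^ 3 * denom (mapGL ℝ σ) z ^ 6)⁻¹ := by
      rw [zpow_neg, zpow_add₀ (hd z), mul_comm 3 k, zpow_mul]; norm_cast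
    rw [this]
    have := zpow_ne_zero k (hd z)
    have := hd z
    simp
    field_simp
  · rw [slash_mapGL_apply, (key z).2.2.2]
    change (denom (mapGL ℝ σ) z ^ k) ^ 2 * denom (mapGL ℝ σ) z ^ 8 / _ * _ * _ = _
    have : denom (mapGL ℝ σ) z ^ (-(2 * k + 8)) =
        ((denom (mapGL ℝ σ) z ^ k) ^ 2 * denom (mapGL ℝ σ) z ^ 8)⁻¹ := by
      rw [zpow_neg, zpow_add₀ (hd z), mul_comm 2 k, zpow_mul]; norm_cast
    rw [this]
    have := zpow_ne_zero k (hd z)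
    have := hd z
    simp
    field_simp

lemma mdifferentiable_jet (hf : MDiff f) (i : Fin 5) :
    MDiff (fun z : ℍ => jet (f ∘ ofComplex) z i) := by
  rw [mdifferentiable_iff] at hf ⊢
  intro z hz
  refine DifferentiableAt.differentiableWithinAt ?_
  refine (hasDerivAt_iteratedDeriv isOpen_upperHalfPlaneSet hf i hz).differentiableAt
    |>.congr_of_eventuallyEq ?_
  filter_upwards [isOpen_upperHalfPlaneSet.mem_nhds hz] with y hy
  simp [jet, ofComplex_apply_of_im_pos hy]

/-- Cauchy's estimate on the unit circle around `z`, which stays in the region where `f` is bounded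
once `Im z` is large. -/
lemma isBoundedAtImInfty_jet (hf : MDiff f) (hb : IsBoundedAtImInfty f) (i : Fin 5) :
    IsBoundedAtImInfty (fun z : ℍ => jet (f ∘ ofComplex) z i) := by
  rw [mdifferentiable_iff] at hf
  rw [isBoundedAtImInfty_iff] at hb ⊢
  obtain ⟨M, A, h⟩ := hb
  refine ⟨(i : ℕ).factorial * M / 1 ^ (i : ℕ), max A 1 + 1, fun z hz => ?_⟩
  have him : ∀ y ∈ Metric.closedBall (z : ℂ) 1, max A 1 ≤ y.im := by
    intro y hy
    have h1 := Complex.abs_im_le_norm (y - z)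
    rw [Metric.mem_closedBall, dist_eq_norm] at hy
    have := abs_le.mp (h1.trans hy)
    simp only [Complex.sub_im, UpperHalfPlane.coe_im] at this
    linarith
  refine Complex.norm_iteratedDeriv_le_of_forall_mem_sphere_norm_le _ one_pos ?_ ?_
  · refine DifferentiableOn.diffContOnCl ?_
    rw [closure_ball _ one_ne_zero]
    exact hf.mono fun y hy => lt_of_lt_of_le one_pos ((le_max_right _ _).trans (him y hy))
  · intro y hy
    have hy' := him y (Metric.sphere_subset_closedBall hy)
    have h0 : 0 < y.im := lt_of_lt_of_le one_pos ((le_max_right _ _).trans hy')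
    rw [Function.comp_apply, ofComplex_apply_of_im_pos h0]
    exact h _ ((le_max_left _ _).trans hy')

/-- A polynomial expression in a jet, built by ring operations from the coordinates, belongs to any
subalgebra containing all coordinates. -/
lemma covariants_mem (S : Subalgebra ℂ (ℍ → ℂ)) {y : ℍ → Fin 5 → ℂ}
    (hy : ∀ i, (fun z => y z i) ∈ S) :
    (fun z => formB k (y z)) ∈ S ∧ (fun z => formA k (y z)) ∈ S ∧ (fun z => formD k (y z)) ∈ S := by
  have hc : ∀ c : ℂ, (fun _ : ℍ => c) ∈ S := fun c => S.algebraMap_mem c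
  refine ⟨?_, ?_, ?_⟩
  · exact S.sub_mem (S.mul_mem (S.mul_mem (hc k) (hy 0)) (hy 2))
      (S.mul_mem (hc (k + 1)) (S.pow_mem (hy 1) 2))
  · exact S.add_mem (S.sub_mem
      (S.mul_mem (S.mul_mem (hc (k ^ 2)) (S.pow_mem (hy 0) 2)) (hy 3))
      (S.mul_mem (S.mul_mem (S.mul_mem (hc (3 * k * (k + 2))) (hy 0)) (hy 1)) (hy 2)))
      (S.mul_mem (hc (2 * (k + 1) * (k + 2))) (S.pow_mem (hy 1) 3))
  · exact S.add_mem (S.sub_mem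
      (S.mul_mem (S.mul_mem (hc (k * (k + 1))) (hy 0)) (hy 4))
      (S.mul_mem (S.mul_mem (hc (4 * (k + 1) * (k + 3))) (hy 1)) (hy 3)))
      (S.mul_mem (hc (3 * (k + 2) * (k + 3))) (S.pow_mem (hy 2) 2))

/-- The algebra of holomorphic functions on `ℍ`. -/
def holomorphicSubalgebra : Subalgebra ℂ (ℍ → ℂ) where
  carrier := {F | MDiff F}
  mul_mem' hF hG := hF.mul hG
  add_mem' hF hG := hF.add hG
  algebraMap_mem' _ := mdifferentiable_const

/-- Holomorphy and boundedness at a cusp both follow from `covariants_mem`, applied to the algebras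
of holomorphic and of bounded functions. -/
lemma IsForm.covariants (hf : IsForm Γ k f) :
    IsForm Γ (2 * k + 4) (fun z : ℍ => formB k (jet (f ∘ ofComplex) z)) ∧
    IsForm Γ (3 * k + 6) (fun z : ℍ => formA k (jet (f ∘ ofComplex) z)) ∧
    IsForm Γ (2 * k + 8) (fun z : ℍ => formD k (jet (f ∘ ofComplex) z)) := by
  obtain ⟨d₁, d₂, d₃⟩ := covariants_mem (k := k) holomorphicSubalgebra
    (mdifferentiable_jet hf.mdiff)
  have hb := fun σ hσ => covariants_mem (k := k) (boundedAtImInftySubalgebra ℂ)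
    (isBoundedAtImInfty_jet (mdifferentiable_slash hf.mdiff k σ) (hf.bdd σ hσ))
  refine ⟨⟨fun γ hγ => ?_, d₁, fun σ hσ => ?_⟩, ⟨fun γ hγ => ?_, d₂, fun σ hσ => ?_⟩,
    ⟨fun γ hγ => ?_, d₃, fun σ hσ => ?_⟩⟩
  · rw [(slash_covariants hf.mdiff γ).1, hf.slash_eq γ hγ]
  · rw [(slash_covariants hf.mdiff σ).1]; exact (hb σ hσ).1
  · rw [(slash_covariants hf.mdiff γ).2.1, hf.slash_eq γ hγ]
  · rw [(slash_covariants hf.mdiff σ).2.1]; exact (hb σ hσ).2.1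
  · rw [(slash_covariants hf.mdiff γ).2.2, hf.slash_eq γ hγ]
  · rw [(slash_covariants hf.mdiff σ).2.2]; exact (hb σ hσ).2.2

end Covariants

/-! ### Cusps -/

/-- At a cusp `σ ∞` of `Γ`, all functions that are invariant under `Γ` have a common period. -/
lemma exists_period_at_cusp {Γ : Subgroup SL(2, ℝ)} {σ : SL(2, ℝ)}
    (hσ : IsCusp (mapGL ℝ σ • (OnePoint.infty : OnePoint ℝ)) (asGL Γ)) :
    ∃ h : ℝ, 0 < h ∧ ∀ (w : ℤ) (F : ℍ → ℂ), (∀ γ ∈ Γ, F ∣[w] mapGL ℝ γ = F) →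
      Function.Periodic ((F ∣[w] mapGL ℝ σ) ∘ ofComplex) h := by
  obtain ⟨_, ⟨γ, hγ, rfl⟩, hpar, hfix⟩ := hσ
  set p : SL(2, ℝ) := σ⁻¹ * γ * σ with hp
  have hp' : mapGL ℝ p = (mapGL ℝ σ)⁻¹ * mapGL ℝ γ * mapGL ℝ σ := by simp [hp]
  have hpinf : mapGL ℝ p • (OnePoint.infty : OnePoint ℝ) = OnePoint.infty := by
    rw [hp', mul_smul, mul_smul]
    erw [hfix]
    exact inv_smul_smul _ _
  rw [OnePoint.smul_infty_eq_self_iff] at hpinf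
  have hppar : (mapGL ℝ p).IsParabolic := by
    rw [hp']
    simpa using hpar
  rw [Matrix.GeneralLinearGroup.isParabolic_iff_of_upperTriangular hpinf] at hppar
  simp only [Matrix.SpecialLinearGroup.mapGL_coe_matrix, Matrix.SpecialLinearGroup.map_apply_coe,
    RingHom.mapMatrix_apply, Matrix.map_apply, Algebra.algebraMap_self, RingHom.id_apply]
    at hpinf hppar
  obtain ⟨h00, h01⟩ := hppar
  have hdet := p.det_coe
  rw [Matrix.det_fin_two, hpinf, ← h00] at hdet
  have hsq : p 0 0 * p 0 0 = 1 := by linarith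
  have hne : p 0 0 ≠ 0 := by rintro h; simp [h] at hsq
  -- The parabolic `p` is upper triangular with equal diagonal entries `±1`. Squaring removes the
  -- sign and leaves the translation by `x`.
  set x : ℝ := 2 * p 0 0 * p 0 1 with hx
  have hx0 : x ≠ 0 := mul_ne_zero (mul_ne_zero two_ne_zero hne) h01
  have hP : ((p * p : SL(2, ℝ)) : Matrix (Fin 2) (Fin 2) ℝ) = !![1, x; 0, 1] := by
    rw [Matrix.SpecialLinearGroup.coe_mul]
    ext i j
    fin_cases i <;> fin_cases j <;>
      simp [Matrix.mul_apply, Fin.sum_univ_two, hpinf, ← h00, hsq, hx]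
    ring
  have hper : ∀ (w : ℤ) (F : ℍ → ℂ), (∀ γ ∈ Γ, F ∣[w] mapGL ℝ γ = F) →
      Function.Periodic ((F ∣[w] mapGL ℝ σ) ∘ ofComplex) (x : ℂ) := by
    intro w F hF z
    have e : (F ∣[w] mapGL ℝ σ) ∣[w] mapGL ℝ (p * p) = F ∣[w] mapGL ℝ σ := by
      rw [← SlashAction.slash_mul, ← map_mul]
      have : σ * (p * p) = (γ * γ) * σ := by rw [hp]; group
      rw [this, map_mul, SlashAction.slash_mul, hF _ (Γ.mul_mem hγ hγ)]
    by_cases hz : 0 < z.im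
    · lift z to ℍ using hz
      have hc : (z : ℂ) + x = ((p * p) • z : ℍ) := by
        rw [coe_specialLinearGroup_apply, hP]; simp
      rw [hc, Function.comp_apply, Function.comp_apply, ofComplex_apply, ofComplex_apply]
      conv_rhs => rw [← e, slash_mapGL_apply]
      have hd : denom (mapGL ℝ (p * p)) z = 1 := by
        simp only [denom, Matrix.SpecialLinearGroup.mapGL_coe_matrix,
          Matrix.SpecialLinearGroup.map_apply_coe, RingHom.mapMatrix_apply, Matrix.map_apply, hP]
        simp
      rw [hd]; simp
    -- Off the half-plane `ofComplex` takes a constant value, and a real translation preserves that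
    -- region.
    · rw [Function.comp_apply, Function.comp_apply, ofComplex_apply_eq_of_im_nonpos]
      · simpa using hz
      · simpa using hz
  rcases lt_or_gt_of_ne hx0 with h | h
  · refine ⟨-x, by linarith, fun w F hF => ?_⟩
    simpa using (hper w F hF).neg
  · exact ⟨x, h, hper⟩

/-! ### A finite cover of `Γ \ ℍ*` by discs and horoballs -/

namespace ExtendedHalfPlane

variable {Γ : Subgroup SL(2, ℝ)}

lemma isOpen_iff {U : Set (ExtendedHalfPlane Γ)} :
    IsOpen U ↔ IsOpen {z : ℍ | point z ∈ U} ∧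
      ∀ (c : OnePoint ℝ) (hc : IsCusp c (asGL Γ)), cusp c hc ∈ U →
        ∀ σ : SL(2, ℝ), mapGL ℝ σ • (OnePoint.infty : OnePoint ℝ) = c →
          ∀ᶠ z in atImInfty, point (σ • z) ∈ U := Iff.rfl

/-- Needed for the projection to the orbit space to be open. -/
instance : ContinuousConstSMul Γ (ExtendedHalfPlane Γ) where
  continuous_const_smul γ := by
    refine continuous_def.mpr fun U hU => ?_
    rw [isOpen_iff] at hU ⊢
    refine ⟨hU.1.preimage (continuous_const_smul (mapGL ℝ (γ : SL(2, ℝ)))),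
      fun c hc hcU σ hσ => ?_⟩
    have := hU.2 _ _ hcU ((γ : SL(2, ℝ)) * σ) (by rw [map_mul, mul_smul, hσ])
    filter_upwards [this] with z hz
    rwa [mul_smul] at hz

/-- An element of `SL(2, ℝ)` mapping `∞` to the given point. -/
noncomputable def scaling (c : OnePoint ℝ) : SL(2, ℝ) := (OnePoint.exists_mem_SL2 ℝ c).choose

lemma scaling_smul (c : OnePoint ℝ) : mapGL ℝ (scaling c) • (OnePoint.infty : OnePoint ℝ) = c :=
  (OnePoint.exists_mem_SL2 ℝ c).choose_spec

/-- A disc around a point of `ℍ`, or a horoball at a cusp. -/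
def chartRegion : ExtendedHalfPlane Γ → Set ℍ
  | point z₀ => {z | ‖(z : ℂ) - z₀‖ < 1 / 2 * ‖(z : ℂ) - (starRingEnd ℂ) z₀‖}
  | cusp c _ => {z | 1 < ((scaling c)⁻¹ • z).im}

lemma isOpen_chartRegion (x : ExtendedHalfPlane Γ) : IsOpen (chartRegion x) := by
  cases x with
  | point z₀ =>
    have := continuous_coe
    exact isOpen_lt (by fun_prop) (by fun_prop)
  | cusp c hc =>
    exact isOpen_lt continuous_const
      (continuous_im.comp (continuous_const_smul (mapGL ℝ (scaling c)⁻¹)))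

lemma mem_chartRegion_point (z : ℍ) :
    z ∈ chartRegion (point z : ExtendedHalfPlane Γ) := by
  have h1 : (z : ℂ) - (starRingEnd ℂ) z ≠ 0 := by
    intro h
    have := congrArg Complex.im h
    simp at this
    exact z.im_ne_zero (by linarith)
  simpa [chartRegion] using h1

/-- At a cusp, two elements of `SL(2, ℝ)` sending `∞` to it differ by a stabilizer of `∞`, which
preserves neighbourhoods of `i∞`; the choice of `scaling` is thus harmless. -/
lemma isOpen_insert_chartRegion (x : ExtendedHalfPlane Γ) :
    IsOpen (insert x (point '' chartRegion x)) := by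
  have htrace : {z : ℍ | point z ∈ insert x (point '' chartRegion x)} = chartRegion x := by
    ext z
    simp only [Set.mem_insert_iff, Set.mem_image, point.injEq, exists_eq_right, Set.mem_ofPred_eq]
    refine or_iff_right_of_imp ?_
    rintro rfl
    exact mem_chartRegion_point z
  refine isOpen_iff.mpr ⟨by rw [htrace]; exact isOpen_chartRegion x, fun c hc hcx σ hσ => ?_⟩
  have hx : x = cusp c hc := by
    rcases hcx with h | ⟨z, -, h⟩
    · exact h.symm
    · cases h
  subst hx
  have h10 : mapGL ℝ ((scaling c)⁻¹ * σ) • (OnePoint.infty : OnePoint ℝ) = OnePoint.infty := by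
    rw [map_mul, mul_smul, hσ, map_inv, inv_smul_eq_iff, scaling_smul]
  rw [OnePoint.smul_infty_eq_self_iff] at h10
  filter_upwards [(tendsto_smul_atImInfty h10).eventually
    (Filter.preimage_mem_comap (Filter.Ioi_mem_atTop 1))] with z hz
  refine Or.inr ⟨σ • z, ?_, rfl⟩
  change 1 < ((scaling c)⁻¹ • σ • z).im
  rw [← mul_smul]
  exact hz

end ExtendedHalfPlane

open ExtendedHalfPlane in
/-- Finitely many discs and horoballs meet every `Γ`-orbit in `ℍ`. -/
lemma IsFuchsianFirstKind.exists_finite_cover {Γ : Subgroup SL(2, ℝ)}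
    (hΓ : IsFuchsianFirstKind Γ) :
    ∃ t : Finset (ExtendedHalfPlane Γ), ∀ z : ℍ, ∃ x ∈ t, ∃ γ ∈ Γ, γ • z ∈ chartRegion x := by
  classical
  have := hΓ.compact
  let π : ExtendedHalfPlane Γ → Quotient (MulAction.orbitRel Γ (ExtendedHalfPlane Γ)) :=
    Quotient.mk _
  have hπ : IsOpenMap π := isOpenMap_quotient_mk'_mul
  obtain ⟨t, ht⟩ := CompactSpace.elim_nhds_subcover
    (fun q : Quotient (MulAction.orbitRel Γ (ExtendedHalfPlane Γ)) =>
      π '' insert q.out (point '' chartRegion q.out)) fun q =>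
    (hπ _ (isOpen_insert_chartRegion q.out)).mem_nhds ⟨q.out, Set.mem_insert _ _, q.out_eq⟩
  refine ⟨t.image Quotient.out, fun z => ?_⟩
  have hz : π (point z) ∈ (⊤ : Set _) := trivial
  rw [← ht] at hz
  simp only [Set.mem_iUnion] at hz
  obtain ⟨q, hq, y, hy, hyz⟩ := hz
  refine ⟨q.out, Finset.mem_image_of_mem _ hq, ?_⟩
  obtain ⟨γ, hγ⟩ := MulAction.orbitRel_apply.mp (Quotient.exact hyz)
  refine ⟨γ, γ.2, ?_⟩
  have hγ' : point ((γ : SL(2, ℝ)) • z) = y := hγ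
  rw [← hγ'] at hy
  rcases hy with h | ⟨z', hz', h⟩
  · rw [← h]
    exact mem_chartRegion_point _
  · rw [point.injEq] at h
    rwa [← h]

/-! ### The invariant norm -/

/-- The `Γ`-invariant function `|F(z)| Im(z)^v` attached to a form `F` of weight `2v`. -/
noncomputable def invNorm (v : ℤ) (F : ℍ → ℂ) (z : ℍ) : ℝ := ‖F z‖ * z.im ^ v

lemma invNorm_smul (v : ℤ) (F : ℍ → ℂ) (σ : SL(2, ℝ)) (z : ℍ) :
    invNorm v F (σ • z) = invNorm v (F ∣[2 * v] mapGL ℝ σ) z := by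
  have hd : ‖denom (mapGL ℝ σ) z‖ ≠ 0 := norm_ne_zero_iff.mpr (denom_ne_zero _ z)
  rw [invNorm, invNorm, slash_mapGL_apply, im_SL_smul, norm_mul, norm_zpow, div_zpow,
    ← zpow_natCast, ← zpow_mul, zpow_neg]
  push_cast
  field_simp

lemma IsForm.invNorm_smul {Γ : Subgroup SL(2, ℝ)} {v : ℤ} {F : ℍ → ℂ} (hF : IsForm Γ (2 * v) F)
    {γ : SL(2, ℝ)} (hγ : γ ∈ Γ) (z : ℍ) : invNorm v F (γ • z) = invNorm v F z := by
  rw [_root_.invNorm_smul, hF.slash_eq γ hγ]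

/-! ### Schwarz's lemma for functions vanishing to high order -/

/-- Schwarz's lemma of order `m`. For `m = n + 1`, a zero of order at least `n + 1` gives the
hypothesis `G = o(|w|^n)` of the general form. -/
lemma norm_le_mul_pow_of_iteratedDeriv_eq_zero {G : ℂ → ℂ} {R K : ℝ} {m : ℕ}
    (hG : DifferentiableOn ℂ G (Metric.ball 0 R)) (hK : ∀ q ∈ Metric.ball 0 R, ‖G q‖ ≤ K)
    (h0 : ∀ n < m, iteratedDeriv n G 0 = 0) {q : ℂ} (hq : q ∈ Metric.ball 0 R) :
    ‖G q‖ ≤ K * (‖q‖ / R) ^ m := by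
  cases m with
  | zero => simpa using hK q hq
  | succ n =>
    have hR : 0 < R := Metric.pos_of_mem_ball hq
    have hG0 : G 0 = 0 := by simpa using h0 0 n.succ_pos
    have han : AnalyticAt ℂ G 0 := hG.analyticAt (Metric.ball_mem_nhds 0 hR)
    have hord := (natCast_le_analyticOrderAt_iff_iteratedDeriv_eq_zero han).mpr h0
    obtain ⟨g, hg, hGg⟩ := (natCast_le_analyticOrderAt han).mp hord
    have ho : (G · - G 0) =o[𝓝 0] (fun w ↦ ‖w - 0‖ ^ n) := by
      simp only [hG0, sub_zero]
      have h1 : (fun w : ℂ => w ^ (n + 1) * g w) =o[𝓝 0] (fun w => w ^ n * (1 : ℂ)) := by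
        have : (fun w : ℂ => w ^ (n + 1) * g w) = fun w => w ^ n * (w * g w) := by
          ext w; ring
        rw [this]
        refine (Asymptotics.isBigO_refl _ _).mul_isLittleO ?_
        rw [Asymptotics.isLittleO_one_iff]
        have : ContinuousAt (fun w : ℂ => w * g w) 0 := continuousAt_id.mul hg.continuousAt
        simpa [ContinuousAt] using this
      refine (h1.norm_right.congr_right fun w => by simp).congr' ?_ Filter.EventuallyEq.rfl
      filter_upwards [hGg] with w hw
      simp [hw]
    have := Complex.dist_le_mul_div_pow_of_mapsTo_ball_of_isLittleO hG
      (fun w hw => by simpa [hG0] using hK w hw) ho hq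
    simpa [hG0] using this

/-- A linear combination whose Taylor coefficients of order `< m` vanish is small near the
origin. -/
lemma norm_sum_le_mul_pow {ι : Type} [Fintype ι] {G : ι → ℂ → ℂ} {R K : ℝ} {m : ℕ} (hR1 : R ≤ 1)
    (hG : ∀ i, DifferentiableOn ℂ (G i) (Metric.ball 0 1)) {c : ι → ℂ}
    (hc : ∀ n : Fin m, ∑ i, c i * iteratedDeriv n (G i) 0 = 0)
    (hK : ∀ q ∈ Metric.ball (0 : ℂ) R, ‖∑ i, c i * G i q‖ ≤ K) {q : ℂ}
    (hq : q ∈ Metric.ball 0 R) : ‖∑ i, c i * G i q‖ ≤ K * (‖q‖ / R) ^ m := by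
  have hd : DifferentiableOn ℂ (fun q => ∑ i, c i * G i q) (Metric.ball 0 1) :=
    DifferentiableOn.fun_sum fun i _ => (hG i).const_mul _
  refine norm_le_mul_pow_of_iteratedDeriv_eq_zero (hd.mono (Metric.ball_subset_ball hR1)) hK ?_ hq
  intro n hn
  have hcd : ∀ i, ContDiffAt ℂ n (G i) 0 := fun i =>
    ((hG i).analyticAt (Metric.ball_mem_nhds 0 one_pos)).contDiffAt
  rw [iteratedDeriv_fun_sum fun i _ => contDiffAt_const.mul (hcd i)]
  simpa using hc ⟨n, hn⟩

/-- Suitable linear conditions, whose number grows linearly with `v`, force linear combinations of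
forms of weight `2v` to be small on the region `D`. -/
def IsControlled (Γ : Subgroup SL(2, ℝ)) (D : Set ℍ) : Prop :=
  ∃ C : ℕ, ∀ v m : ℕ, C * (v + 1) ≤ m → ∀ (ι : Type) [Fintype ι] (F : ι → ℍ → ℂ),
    (∀ i, IsForm Γ (2 * v) (F i)) → ∃ a : ι → Fin m → ℂ, ∀ c : ι → ℂ,
      (∀ n, ∑ i, c i * a i n = 0) →
        (∃ K, ∀ z ∈ D, invNorm v (∑ i, c i • F i) z ≤ K) ∧
        ∀ M, (∀ z, invNorm v (∑ i, c i • F i) z ≤ M) →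
          ∀ z ∈ D, invNorm v (∑ i, c i • F i) z ≤ M / 2

/-! ### Discs -/

section Disc

/-- The inverse of the Cayley transform `z ↦ (z - z₀) / (z - conj z₀)`. -/
noncomputable def cayleyInv (z₀ : ℍ) (w : ℂ) : ℂ := (z₀ - (starRingEnd ℂ) z₀ * w) / (1 - w)

/-- The function on the unit disc corresponding to a form `F` of weight `2v`. -/
noncomputable def discFun (z₀ : ℍ) (v : ℤ) (F : ℍ → ℂ) (w : ℂ) : ℂ :=
  F (ofComplex (cayleyInv z₀ w)) * (1 - w) ^ (-(2 * v))

lemma one_sub_ne_zero_of_norm_lt {w : ℂ} (hw : ‖w‖ < 1) : 1 - w ≠ 0 := by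
  rintro h
  rw [sub_eq_zero] at h
  simp [← h] at hw

lemma im_cayleyInv (z₀ : ℍ) {w : ℂ} (hw : ‖w‖ < 1) :
    (cayleyInv z₀ w).im = z₀.im * (1 - ‖w‖ ^ 2) / ‖1 - w‖ ^ 2 := by
  have h : Complex.normSq (1 - w) ≠ 0 := by
    simpa using one_sub_ne_zero_of_norm_lt hw
  rw [← Complex.normSq_eq_norm_sq, ← Complex.normSq_eq_norm_sq, cayleyInv, Complex.div_im]
  field_simp
  simp [Complex.normSq_apply]
  ring

lemma im_cayleyInv_pos (z₀ : ℍ) {w : ℂ} (hw : ‖w‖ < 1) : 0 < (cayleyInv z₀ w).im := by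
  rw [im_cayleyInv z₀ hw]
  have h1 : 0 < ‖1 - w‖ := norm_pos_iff.mpr (one_sub_ne_zero_of_norm_lt hw)
  have h2 : 0 < 1 - ‖w‖ ^ 2 := by nlinarith [norm_nonneg w]
  have := z₀.im_pos
  positivity

lemma differentiableOn_discFun (z₀ : ℍ) (v : ℤ) {F : ℍ → ℂ} (hF : MDiff F) :
    DifferentiableOn ℂ (discFun z₀ v F) (Metric.ball 0 1) := by
  intro w hw
  have hw' : ‖w‖ < 1 := by simpa using hw
  have h1 := one_sub_ne_zero_of_norm_lt hw'
  refine DifferentiableAt.differentiableWithinAt ?_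
  refine DifferentiableAt.mul ?_ ?_
  · have hd : DifferentiableAt ℂ (cayleyInv z₀) w := by
      unfold cayleyInv
      fun_prop (disch := assumption)
    exact ((UpperHalfPlane.mdifferentiable_iff.mp hF).differentiableAt
      (isOpen_upperHalfPlaneSet.mem_nhds (im_cayleyInv_pos z₀ hw'))).comp w hd
  · exact (differentiableAt_zpow.mpr (Or.inl h1)).comp w (by fun_prop)

lemma invNorm_cayleyInv (z₀ : ℍ) (v : ℤ) (F : ℍ → ℂ) {w : ℂ} (hw : ‖w‖ < 1) :
    invNorm v F (ofComplex (cayleyInv z₀ w)) =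
      z₀.im ^ v * (‖discFun z₀ v F w‖ * (1 - ‖w‖ ^ 2) ^ v) := by
  have h1 : ‖1 - w‖ ≠ 0 := norm_ne_zero_iff.mpr (one_sub_ne_zero_of_norm_lt hw)
  have him : (ofComplex (cayleyInv z₀ w)).im = (cayleyInv z₀ w).im := by
    rw [ofComplex_apply_of_im_pos (im_cayleyInv_pos z₀ hw)]; rfl
  rw [invNorm, him, im_cayleyInv z₀ hw, discFun, norm_mul, norm_zpow, div_zpow, mul_zpow,
    ← zpow_natCast ‖1 - w‖ 2, ← zpow_mul, zpow_neg]
  push_cast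
  field_simp

lemma exists_cayleyInv_eq (z₀ z : ℍ) :
    ∃ w : ℂ, w * (z - (starRingEnd ℂ) z₀) = z - z₀ ∧ ‖w‖ < 1 ∧
      ofComplex (cayleyInv z₀ w) = z := by
  have h0 : (z : ℂ) - (starRingEnd ℂ) z₀ ≠ 0 := by
    intro h
    have := congrArg Complex.im h
    simp at this
    linarith [z.im_pos, z₀.im_pos]
  have hz0 : (z₀ : ℂ) - (starRingEnd ℂ) z₀ ≠ 0 := by
    intro h
    have := congrArg Complex.im h
    simp at this
    linarith [z₀.im_pos]
  refine ⟨(z - z₀) / (z - (starRingEnd ℂ) z₀), div_mul_cancel₀ _ h0, ?_, ?_⟩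
  · rw [norm_div, div_lt_one (norm_pos_iff.mpr h0)]
    refine lt_of_pow_lt_pow_left₀ 2 (norm_nonneg _) ?_
    rw [← Complex.normSq_eq_norm_sq, ← Complex.normSq_eq_norm_sq, Complex.normSq_apply,
      Complex.normSq_apply]
    simp
    nlinarith [mul_pos z.im_pos z₀.im_pos]
  · have : cayleyInv z₀ ((z - z₀) / (z - (starRingEnd ℂ) z₀)) = z := by
      have e : 1 - ((z : ℂ) - z₀) / (z - (starRingEnd ℂ) z₀) =
          (z₀ - (starRingEnd ℂ) z₀) / (z - (starRingEnd ℂ) z₀) := by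
        rw [eq_div_iff h0, sub_mul, div_mul_cancel₀ _ h0]; ring
      rw [cayleyInv, e]
      field_simp
      ring
    rw [this, ofComplex_apply]

lemma discFun_sum (z₀ : ℍ) (v : ℤ) {ι : Type} [Fintype ι] (F : ι → ℍ → ℂ) (c : ι → ℂ) (w : ℂ) :
    discFun z₀ v (∑ i, c i • F i) w = ∑ i, c i * discFun z₀ v (F i) w := by
  simp [discFun, Finset.sum_mul, mul_assoc]

lemma exists_cayleyInv_eq_of_norm_lt {z₀ z : ℍ}
    (hz : ‖(z : ℂ) - z₀‖ < 1 / 2 * ‖(z : ℂ) - (starRingEnd ℂ) z₀‖) :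
    ∃ w : ℂ, ‖w‖ < 1 / 2 ∧ ofComplex (cayleyInv z₀ w) = z := by
  obtain ⟨w, hw, -, hwz⟩ := exists_cayleyInv_eq z₀ z
  refine ⟨w, ?_, hwz⟩
  rw [← hw, norm_mul] at hz
  exact lt_of_mul_lt_mul_right hz (norm_nonneg _)

/-- The conditions are the vanishing of `m` Taylor coefficients at the centre. Shrinking the radius
from `3/4` to `1/2` gains `(2/3)^m ≤ (8/27)^(v+1)`; the weight factor `(1-|w|²)^v` costs at most
`(16/7)^v`. Since `(16/7)(8/27) < 1`, a factor `8/27 < 1/2` is left over. -/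
lemma isControlled_disc (Γ : Subgroup SL(2, ℝ)) (z₀ : ℍ) :
    IsControlled Γ {z | ‖(z : ℂ) - z₀‖ < 1 / 2 * ‖(z : ℂ) - (starRingEnd ℂ) z₀‖} := by
  refine ⟨3, fun v m hm ι _ F hF => ⟨fun i n => iteratedDeriv n (discFun z₀ v (F i)) 0, ?_⟩⟩
  intro c hc
  have hdiff := fun i => differentiableOn_discFun z₀ v (hF i).mdiff
  have hy0 : (0 : ℝ) < z₀.im ^ v := pow_pos z₀.im_pos v
  -- a bound on the disc of radius `3/4` improves on the disc of radius `1/2`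
  have key : ∀ M, (∀ w : ℂ, ‖w‖ < 3 / 4 →
      z₀.im ^ v * ‖∑ i, c i * discFun z₀ v (F i) w‖ ≤ M * (16 / 7) ^ v) →
      ∀ z ∈ {z : ℍ | ‖(z : ℂ) - z₀‖ < 1 / 2 * ‖(z : ℂ) - (starRingEnd ℂ) z₀‖},
        invNorm v (∑ i, c i • F i) z ≤ M / 2 := by
    intro M hM z hz
    obtain ⟨w, hw, rfl⟩ := exists_cayleyInv_eq_of_norm_lt hz
    have hM0 : 0 ≤ M := by
      have h1 := (mul_nonneg hy0.le (norm_nonneg _)).trans (hM w (by linarith))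
      exact nonneg_of_mul_nonneg_left h1 (by positivity)
    rw [invNorm_cayleyInv z₀ v _ (by linarith), discFun_sum, zpow_natCast, zpow_natCast]
    have h1 := norm_sum_le_mul_pow (R := 3 / 4) (K := M * (16 / 7) ^ v / z₀.im ^ v) (by norm_num)
      hdiff hc (fun q hq => by
        rw [le_div_iff₀ hy0, mul_comm]
        exact hM q (by simpa using hq)) (q := w) (by simp; linarith)
    have h2 : (‖w‖ / (3 / 4)) ^ m ≤ (8 / 27) * (8 / 27) ^ v := by
      calc (‖w‖ / (3 / 4)) ^ m ≤ (2 / 3) ^ m := by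
            refine pow_le_pow_left₀ (by positivity) ?_ m
            rw [div_le_iff₀ (by norm_num)]; linarith
        _ ≤ (2 / 3) ^ (3 * (v + 1)) := pow_le_pow_of_le_one (by norm_num) (by norm_num) hm
        _ = (8 / 27) * (8 / 27) ^ v := by rw [pow_mul]; norm_num [pow_succ, mul_comm]
    have h3 : (1 - ‖w‖ ^ 2) ^ v ≤ 1 :=
      pow_le_one₀ (by nlinarith [norm_nonneg w]) (by nlinarith [norm_nonneg w])
    have h4 : ((16 : ℝ) / 7) ^ v * (8 / 27) ^ v ≤ 1 := by
      rw [← mul_pow]; exact pow_le_one₀ (by norm_num) (by norm_num)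
    calc z₀.im ^ v * (‖∑ i, c i * discFun z₀ v (F i) w‖ * (1 - ‖w‖ ^ 2) ^ v)
        ≤ z₀.im ^ v * (‖∑ i, c i * discFun z₀ v (F i) w‖ * 1) := by gcongr
      _ ≤ z₀.im ^ v * (M * (16 / 7) ^ v / z₀.im ^ v * ((8 / 27) * (8 / 27) ^ v)) := by
          rw [mul_one]
          gcongr
          exact h1.trans (by gcongr)
      _ = M * (8 / 27) * ((16 / 7) ^ v * (8 / 27) ^ v) := by field_simp
      _ ≤ M * (8 / 27) * 1 := by gcongr
      _ ≤ M / 2 := by linarith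
  refine ⟨?_, fun M hM => key M fun w hw => ?_⟩
  -- An a priori bound by compactness: the global supremum is not yet known to be finite.
  · have hcont : ContinuousOn (fun w => ∑ i, c i * discFun z₀ v (F i) w)
        (Metric.closedBall 0 (3 / 4)) :=
      ((DifferentiableOn.fun_sum fun i _ => (hdiff i).const_mul _).continuousOn).mono
        (Metric.closedBall_subset_ball (by norm_num))
    obtain ⟨K, hK⟩ := (isCompact_closedBall (0 : ℂ) (3 / 4)).exists_bound_of_continuousOn hcont
    refine ⟨_, key (z₀.im ^ v * K / (16 / 7) ^ v) fun w hw => ?_⟩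
    rw [div_mul_cancel₀ _ (by positivity)]
    exact mul_le_mul_of_nonneg_left (hK w (by simpa using hw.le)) hy0.le
  · have h1 := hM (ofComplex (cayleyInv z₀ w))
    rw [invNorm_cayleyInv z₀ v _ (by linarith), discFun_sum, zpow_natCast, zpow_natCast] at h1
    have h2 : (7 / 16 : ℝ) ^ v ≤ (1 - ‖w‖ ^ 2) ^ v :=
      pow_le_pow_left₀ (by norm_num) (by nlinarith [norm_nonneg w]) v
    have h3 : ((16 : ℝ) / 7) ^ v * (7 / 16) ^ v = 1 := by rw [← mul_pow]; norm_num
    calc z₀.im ^ v * ‖∑ i, c i * discFun z₀ v (F i) w‖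
        = z₀.im ^ v * (‖∑ i, c i * discFun z₀ v (F i) w‖ * (7 / 16) ^ v) * (16 / 7) ^ v := by
          linear_combination (-(z₀.im ^ v * ‖∑ i, c i * discFun z₀ v (F i) w‖)) * h3
      _ ≤ z₀.im ^ v * (‖∑ i, c i * discFun z₀ v (F i) w‖ * (1 - ‖w‖ ^ 2) ^ v) *
          (16 / 7) ^ v := by gcongr
      _ ≤ M * (16 / 7) ^ v := by gcongr

end Disc

/-! ### Horoballs -/

section Horoball

open Function.Periodic

/-- In the coordinate `q = e^(2πiz/h)` the conditions are the vanishing of `m` coefficients of the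
`q`-expansion. A bound at height `1/2`, that is on `|q| = R`, improves at height `y > 1` by
`e^(-m(π/h)(2y-1)) ≤ e^(-(v+1)(2y-1))`. This beats the growth `(2y)^v ≤ e^(v(2y-1))` and leaves a
factor at most `e⁻¹ ≤ 1/2`. -/
lemma isControlled_horoball {Γ : Subgroup SL(2, ℝ)} {σ : SL(2, ℝ)}
    (hσ : IsCusp (mapGL ℝ σ • (OnePoint.infty : OnePoint ℝ)) (asGL Γ)) :
    IsControlled Γ {z | 1 < (σ⁻¹ • z).im} := by
  obtain ⟨h, hh, hper⟩ := exists_period_at_cusp hσ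
  refine ⟨⌈h / Real.pi⌉₊, fun v m hm ι _ F hF => ?_⟩
  set G : ι → ℂ → ℂ := fun i => cuspFunction h (F i ∣[(2 * v : ℤ)] mapGL ℝ σ) with hGdef
  refine ⟨fun i n => iteratedDeriv n (G i) 0, fun c hc => ?_⟩
  have hperF := fun i => hper (2 * v) (F i) (hF i).slash_eq
  have hdiff : ∀ i, DifferentiableOn ℂ (G i) (Metric.ball 0 1) := fun i =>
    differentiableOn_cuspFunction_ball hh (hperF i) (mdifferentiable_slash (hF i).mdiff _ σ)
      ((hF i).bdd σ hσ)
  have hval : ∀ z : ℍ, ((∑ i, c i • F i) ∣[(2 * v : ℤ)] mapGL ℝ σ) z =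
      ∑ i, c i * G i (qParam h z) := by
    intro z
    rw [SlashAction.sum_slash, Finset.sum_apply]
    refine Finset.sum_congr rfl fun i _ => ?_
    rw [smul_slash_mapGL, Pi.smul_apply, smul_eq_mul]
    simp only [hGdef]
    rw [UpperHalfPlane.eq_cuspFunction z hh.ne' (hperF i)]
  have hnorm : ∀ z : ℍ, invNorm v (∑ i, c i • F i) (σ • z) =
      ‖∑ i, c i * G i (qParam h z)‖ * z.im ^ v := by
    intro z
    rw [invNorm_smul, invNorm, hval, zpow_natCast]
  set R : ℝ := Real.exp (-Real.pi / h) with hR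
  have hR0 : 0 < R := Real.exp_pos _
  have hR1 : R < 1 := by
    rw [hR, Real.exp_lt_one_iff]
    exact div_neg_of_neg_of_pos (neg_neg_of_pos Real.pi_pos) hh
  have hm' : (v : ℝ) + 1 ≤ m * (Real.pi / h) := by
    have h1 : h / Real.pi * (v + 1) ≤ m := by
      have h2 : (⌈h / Real.pi⌉₊ : ℝ) * (v + 1) ≤ m := by exact_mod_cast hm
      exact le_trans (by gcongr; exact Nat.le_ceil _) h2
    have hπ := Real.pi_pos
    calc (v : ℝ) + 1 = h / Real.pi * (v + 1) * (Real.pi / h) := by field_simp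
      _ ≤ m * (Real.pi / h) := by gcongr
  have hcont : ContinuousOn (fun q => ∑ i, c i * G i q) (Metric.closedBall 0 R) :=
    ((DifferentiableOn.fun_sum fun i _ => (hdiff i).const_mul _).continuousOn).mono
      (Metric.closedBall_subset_ball hR1)
  have key : ∀ M, (∀ q ∈ Metric.ball (0 : ℂ) R, ‖∑ i, c i * G i q‖ ≤ M * 2 ^ v) →
      ∀ z ∈ {z : ℍ | 1 < (σ⁻¹ • z).im}, invNorm v (∑ i, c i • F i) z ≤ M / 2 := by
    intro M hM z hz
    obtain ⟨z, rfl⟩ : ∃ z', z = σ • z' := ⟨σ⁻¹ • z, by simp⟩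
    replace hz : 1 < z.im := by simpa using hz
    have hM0 : 0 ≤ M := by
      have h1 := (norm_nonneg _).trans (hM 0 (Metric.mem_ball_self hR0))
      exact nonneg_of_mul_nonneg_left h1 (by positivity)
    have hq : ‖qParam h z‖ = R * Real.exp (-(Real.pi / h) * (2 * z.im - 1)) := by
      rw [norm_qParam, hR, ← Real.exp_add]
      congr 1
      simp only [UpperHalfPlane.coe_im]
      field_simp
      ring
    have hq1 : qParam h z ∈ Metric.ball (0 : ℂ) R := by
      rw [mem_ball_zero_iff, hq]
      refine mul_lt_of_lt_one_right hR0 (Real.exp_lt_one_iff.mpr ?_)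
      have : 0 < Real.pi / h := div_pos Real.pi_pos hh
      nlinarith
    have h1 := norm_sum_le_mul_pow hR1.le hdiff hc hM hq1
    rw [hq, mul_div_cancel_left₀ _ hR0.ne', ← Real.exp_nat_mul] at h1
    have h2 : Real.exp (m * (-(Real.pi / h) * (2 * z.im - 1))) ≤
        Real.exp (-((v + 1) * (2 * z.im - 1))) := by
      rw [Real.exp_le_exp]
      nlinarith
    have h3 : (2 : ℝ) ^ v * z.im ^ v ≤ Real.exp (v * (2 * z.im - 1)) := by
      rw [← mul_pow, Real.exp_nat_mul]
      refine pow_le_pow_left₀ (by linarith) ?_ v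
      linarith [Real.add_one_le_exp (2 * z.im - 1)]
    have h4 : Real.exp (v * (2 * z.im - 1)) * Real.exp (-((v + 1) * (2 * z.im - 1))) ≤ 1 / 2 := by
      rw [← Real.exp_add]
      have : Real.exp (v * (2 * z.im - 1) + -((v + 1) * (2 * z.im - 1))) ≤ Real.exp (-1) := by
        rw [Real.exp_le_exp]; linarith
      refine this.trans ?_
      rw [Real.exp_neg, one_div]
      exact inv_anti₀ two_pos (by linarith [Real.add_one_le_exp (1 : ℝ)])
    rw [hnorm]
    have hz0 := z.im_pos
    calc ‖∑ i, c i * G i (qParam h z)‖ * z.im ^ v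
        ≤ M * 2 ^ v * Real.exp (-((v + 1) * (2 * z.im - 1))) * z.im ^ v := by
          gcongr
          exact h1.trans (by gcongr)
      _ = M * (2 ^ v * z.im ^ v * Real.exp (-((v + 1) * (2 * z.im - 1)))) := by ring
      _ ≤ M * (1 / 2) := by
          gcongr
          exact le_trans (by gcongr) h4
      _ = M / 2 := by ring
  refine ⟨?_, fun M hM => key M fun q hq => ?_⟩
  · obtain ⟨K, hK⟩ := (isCompact_closedBall (0 : ℂ) R).exists_bound_of_continuousOn hcont
    refine ⟨_, key (K / 2 ^ v) fun q hq => ?_⟩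
    rw [div_mul_cancel₀ _ (by positivity)]
    exact hK q (Metric.ball_subset_closedBall hq)
  -- By the maximum principle it is enough to bound the sum on `|q| = R`. Its points come from `Im z
  -- = 1/2`, where the weight factor is `2^(-v)`; this also covers `q = 0`.
  · have hd : DiffContOnCl ℂ (fun q => ∑ i, c i * G i q) (Metric.ball 0 R) := by
      refine DifferentiableOn.diffContOnCl ?_
      rw [closure_ball _ hR0.ne']
      exact (DifferentiableOn.fun_sum fun i _ => (hdiff i).const_mul _).mono
        (Metric.closedBall_subset_ball hR1)
    refine Complex.norm_le_of_forall_mem_frontier_norm_le Metric.isBounded_ball hd ?_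
      (subset_closure hq)
    intro q hq
    rw [frontier_ball _ hR0.ne', mem_sphere_zero_iff_norm] at hq
    have hq0 : q ≠ 0 := by
      rintro rfl
      simp at hq
      exact hR0.ne hq
    have him : (invQParam h q).im = 1 / 2 := by
      rw [im_invQParam, hq, hR, Real.log_exp]
      field_simp
    have h1 := hM (σ • ⟨invQParam h q, by rw [him]; norm_num⟩)
    rw [hnorm, UpperHalfPlane.coe_mk, qParam_right_inv hh.ne' hq0, UpperHalfPlane.mk_im] at h1
    rw [him, one_div, inv_pow] at h1
    rwa [← div_eq_mul_inv, div_le_iff₀ (by positivity)] at h1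

end Horoball

/-! ### Linear relations between forms -/

open ExtendedHalfPlane in
lemma isControlled_chartRegion {Γ : Subgroup SL(2, ℝ)} (x : ExtendedHalfPlane Γ) :
    IsControlled Γ (chartRegion x) := by
  cases x with
  | point z₀ => exact isControlled_disc Γ z₀
  | cusp c hc => exact isControlled_horoball (by rwa [scaling_smul])

/-- The dimension of the space of forms of weight `2v` grows at most linearly with `v`. -/
theorem IsFuchsianFirstKind.exists_linear_relation {Γ : Subgroup SL(2, ℝ)}
    (hΓ : IsFuchsianFirstKind Γ) :
    ∃ C : ℕ, ∀ (v : ℕ) (ι : Type) [Fintype ι] (F : ι → ℍ → ℂ), (∀ i, IsForm Γ (2 * v) (F i)) →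
      C * (v + 1) < Fintype.card ι → ∃ c : ι → ℂ, c ≠ 0 ∧ ∑ i, c i • F i = 0 := by
  classical
  obtain ⟨t, ht⟩ := hΓ.exists_finite_cover
  choose C hC using fun x : ExtendedHalfPlane Γ => isControlled_chartRegion x
  refine ⟨t.card * ∑ x ∈ t, C x, fun v ι _ F hF hcard => ?_⟩
  -- One number of conditions that suffices for all regions, so that the conditions are indexed by
  -- `t × Fin m`.
  set m := (∑ x ∈ t, C x) * (v + 1) with hm
  have hCm : ∀ x : t, C x * (v + 1) ≤ m := fun x =>
    Nat.mul_le_mul_right _ (Finset.single_le_sum (f := C) (fun _ _ => Nat.zero_le _) x.2)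
  choose a ha using fun x : t => hC x v m (hCm x) ι F hF
  let L : (ι → ℂ) →ₗ[ℂ] (t × Fin m → ℂ) :=
    Fintype.linearCombination ℂ fun i (p : t × Fin m) => a p.1 i p.2
  have hker : LinearMap.ker L ≠ ⊥ := by
    refine LinearMap.ker_ne_bot_of_finrank_lt ?_
    simp only [Module.finrank_fintype_fun_eq_card, Fintype.card_prod, Fintype.card_coe,
      Fintype.card_fin]
    rwa [hm, ← mul_assoc]
  obtain ⟨c, hcL, hc0⟩ := (Submodule.ne_bot_iff _).mp hker
  refine ⟨c, hc0, ?_⟩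
  have hzero : ∀ (x : t) n, ∑ i, c i * a x i n = 0 := by
    intro x n
    have := congrFun (LinearMap.mem_ker.mp hcL) (x, n)
    simpa [L, Fintype.linearCombination_apply] using this
  have hS : IsForm Γ (2 * v) (∑ i, c i • F i) := IsForm.sum _ fun i _ => (hF i).smul _
  set φ := invNorm v (∑ i, c i • F i) with hφ
  choose K hK using fun x : t => (ha x c (hzero x)).1
  have hbdd : ∀ z, φ z ≤ ∑ x, |K x| := by
    intro z
    obtain ⟨x, hx, γ, hγ, hz⟩ := ht z
    rw [hφ, ← hS.invNorm_smul hγ]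
    exact (hK ⟨x, hx⟩ _ hz).trans ((le_abs_self _).trans
      (Finset.single_le_sum (f := fun x => |K x|) (fun _ _ => abs_nonneg _) (Finset.mem_univ _)))
  have hBA : BddAbove (Set.range φ) := ⟨_, by rintro _ ⟨z, rfl⟩; exact hbdd z⟩
  -- Invariance moves any point into some region, where the norm is at most half the supremum. The
  -- supremum is finite, so it is `≤ 0`.
  have hhalf : ∀ z, φ z ≤ (⨆ z, φ z) / 2 := by
    intro z
    obtain ⟨x, hx, γ, hγ, hz⟩ := ht z
    rw [hφ, ← hS.invNorm_smul hγ]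
    exact (ha ⟨x, hx⟩ c (hzero _)).2 _ (le_ciSup hBA) _ hz
  have hsup : ⨆ z, φ z ≤ 0 := by
    have := ciSup_le hhalf
    linarith
  ext z
  have h1 : φ z ≤ 0 := (le_ciSup hBA z).trans hsup
  have h2 : ‖(∑ i, c i • F i) z‖ ≤ 0 := nonpos_of_mul_nonpos_left h1 (zpow_pos z.im_pos _)
  simpa using h2

/-! ### Forms of weight `≤ 0` -/

lemma exists_invNorm_le_disc (z₀ : ℍ) (v : ℤ) {F : ℍ → ℂ} (hF : MDiff F) :
    ∃ K, ∀ z ∈ {z : ℍ | ‖(z : ℂ) - z₀‖ < 1 / 2 * ‖(z : ℂ) - (starRingEnd ℂ) z₀‖},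
      invNorm v F z ≤ K := by
  have hcont : ContinuousOn (fun w => z₀.im ^ v * (‖discFun z₀ v F w‖ * (1 - ‖w‖ ^ 2) ^ v))
      (Metric.closedBall (0 : ℂ) (1 / 2)) := by
    refine continuousOn_const.mul (ContinuousOn.mul ?_ ?_)
    · exact ((differentiableOn_discFun z₀ v hF).continuousOn.mono
        (Metric.closedBall_subset_ball (by norm_num))).norm
    · refine ContinuousOn.zpow₀ (by fun_prop) v fun w hw => Or.inl ?_
      rw [mem_closedBall_zero_iff] at hw
      nlinarith [norm_nonneg w]
  obtain ⟨K, hK⟩ := (isCompact_closedBall (0 : ℂ) (1 / 2)).exists_bound_of_continuousOn hcont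
  refine ⟨K, fun z hz => ?_⟩
  obtain ⟨w, hw, rfl⟩ := exists_cayleyInv_eq_of_norm_lt hz
  rw [invNorm_cayleyInv z₀ v F (by linarith)]
  exact (le_abs_self _).trans (hK w (by simpa using hw.le))

open Function.Periodic in
-- The function of `q` is bounded on the smaller closed disc, and `v ≤ 0` gives `(Im z)^v ≤ 1` on
-- the horoball.
lemma IsForm.exists_invNorm_le_horoball {Γ : Subgroup SL(2, ℝ)} {σ : SL(2, ℝ)} {v : ℤ}
    (hv : v ≤ 0) {F : ℍ → ℂ} (hF : IsForm Γ (2 * v) F)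
    (hσ : IsCusp (mapGL ℝ σ • (OnePoint.infty : OnePoint ℝ)) (asGL Γ)) :
    ∃ K, ∀ z ∈ {z : ℍ | 1 < (σ⁻¹ • z).im}, invNorm v F z ≤ K := by
  obtain ⟨h, hh, hper⟩ := exists_period_at_cusp hσ
  have hperF := hper (2 * v) F hF.slash_eq
  have hdiff := differentiableOn_cuspFunction_ball hh hperF
    (mdifferentiable_slash hF.mdiff _ σ) (hF.bdd σ hσ)
  have hR1 : Real.exp (-2 * Real.pi * 1 / h) < 1 := by
    rw [Real.exp_lt_one_iff]
    exact div_neg_of_neg_of_pos (by linarith [Real.pi_pos]) hh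
  obtain ⟨K, hK⟩ := (isCompact_closedBall (0 : ℂ) _).exists_bound_of_continuousOn
    (hdiff.continuousOn.mono (Metric.closedBall_subset_ball hR1))
  refine ⟨K, fun z hz => ?_⟩
  obtain ⟨z, rfl⟩ : ∃ z', z = σ • z' := ⟨σ⁻¹ • z, by simp⟩
  replace hz : 1 < z.im := by simpa using hz
  rw [_root_.invNorm_smul, invNorm, ← UpperHalfPlane.eq_cuspFunction z hh.ne' hperF]
  have h1 : qParam h z ∈ Metric.closedBall (0 : ℂ) (Real.exp (-2 * Real.pi * 1 / h)) := by
    rw [mem_closedBall_zero_iff, norm_qParam, Real.exp_le_exp]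
    refine div_le_div_of_nonneg_right ?_ hh.le
    simp only [UpperHalfPlane.coe_im]
    nlinarith [Real.pi_pos]
  have h2 := hK _ h1
  have h3 : z.im ^ v ≤ 1 := zpow_le_one_of_nonpos₀ hz.le hv
  exact (mul_le_of_le_one_right (norm_nonneg _) h3).trans h2

open ExtendedHalfPlane in
/-- For `v ≤ 0` the invariant norm of a form of weight `2v` is bounded. -/
lemma IsForm.exists_invNorm_le {Γ : Subgroup SL(2, ℝ)} (hΓ : IsFuchsianFirstKind Γ) {v : ℤ}
    (hv : v ≤ 0) {F : ℍ → ℂ} (hF : IsForm Γ (2 * v) F) : ∃ M, ∀ z, invNorm v F z ≤ M := by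
  obtain ⟨t, ht⟩ := hΓ.exists_finite_cover
  have hloc : ∀ x : ExtendedHalfPlane Γ, ∃ K, ∀ z ∈ chartRegion x, invNorm v F z ≤ K := by
    intro x
    cases x with
    | point z₀ => exact exists_invNorm_le_disc z₀ v hF.mdiff
    | cusp c hc => exact hF.exists_invNorm_le_horoball hv (by rwa [scaling_smul])
  choose K hK using hloc
  refine ⟨∑ x ∈ t, |K x|, fun z => ?_⟩
  obtain ⟨x, hx, γ, hγ, hz⟩ := ht z
  rw [← hF.invNorm_smul hγ]
  exact (hK x _ hz).trans ((le_abs_self _).trans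
    (Finset.single_le_sum (f := fun x => |K x|) (fun _ _ => abs_nonneg _) hx))

/-- There are no forms of negative weight. -/
theorem IsForm.eq_zero_of_neg {Γ : Subgroup SL(2, ℝ)} (hΓ : IsFuchsianFirstKind Γ) {w : ℤ}
    (hw : w < 0) {F : ℍ → ℂ} (hF : IsForm Γ w F) : F = 0 := by
  -- Squaring makes the weight even, as `invNorm` requires.
  have hF2 : IsForm Γ (2 * w) (F ^ 2) := by simpa using hF.pow 2
  obtain ⟨M, hM⟩ := hF2.exists_invNorm_le hΓ hw.le
  obtain ⟨n, hn⟩ := Int.exists_eq_neg_ofNat hw.le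
  have hn0 : n ≠ 0 := by rintro rfl; simp [hn] at hw
  ext z₀
  suffices (F ^ 2) z₀ = 0 by simpa using this
  have hd := differentiableOn_discFun z₀ w hF2.mdiff
  have h0 : discFun z₀ w (F ^ 2) 0 = (F ^ 2) z₀ := by simp [discFun, cayleyInv]
  have hy : (0 : ℝ) < z₀.im ^ w := zpow_pos z₀.im_pos _
  rw [← h0, ← norm_le_zero_iff]
  -- In disc coordinates a bounded invariant norm of negative weight forces decay `(1-r²)^n` on `|w|
  -- = r`. The maximum principle carries this to the centre, and `r → 1` gives zero.
  have hle : ∀ r : ℝ, 0 < r → r < 1 →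
      ‖discFun z₀ w (F ^ 2) 0‖ ≤ M / z₀.im ^ w * (1 - r ^ 2) ^ n := by
    intro r hr0 hr1
    have hdr : DiffContOnCl ℂ (discFun z₀ w (F ^ 2)) (Metric.ball 0 r) := by
      refine DifferentiableOn.diffContOnCl ?_
      rw [closure_ball _ hr0.ne']
      exact hd.mono (Metric.closedBall_subset_ball hr1)
    refine Complex.norm_le_of_forall_mem_frontier_norm_le Metric.isBounded_ball hdr ?_
      (subset_closure (Metric.mem_ball_self hr0))
    intro q hq
    rw [frontier_ball _ hr0.ne', mem_sphere_zero_iff_norm] at hq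
    have h1 := hM (ofComplex (cayleyInv z₀ q))
    rw [invNorm_cayleyInv z₀ w _ (by linarith), hq, hn] at h1
    rw [hn]
    have h2 : 0 < 1 - r ^ 2 := by nlinarith
    rw [zpow_neg (1 - r ^ 2), zpow_natCast] at h1
    rw [hn] at hy
    rw [div_mul_eq_mul_div, le_div_iff₀ hy]
    have h3 := mul_le_mul_of_nonneg_right h1 (pow_nonneg h2.le n)
    refine le_trans (le_of_eq ?_) h3
    field_simp
  have hlim : Filter.Tendsto (fun r : ℝ => M / z₀.im ^ w * (1 - r ^ 2) ^ n) (𝓝[<] 1)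
      (𝓝 0) := by
    have : ContinuousAt (fun r : ℝ => M / z₀.im ^ w * (1 - r ^ 2) ^ n) 1 := by fun_prop
    have h := this.tendsto
    simp only [one_pow, sub_self, zero_pow hn0, mul_zero] at h
    exact h.mono_left nhdsWithin_le_nhds
  refine ge_of_tendsto hlim ?_
  filter_upwards [Ioo_mem_nhdsLT (zero_lt_one (α := ℝ))] with r hr using hle r hr.1 hr.2

/-- A form on `ℍ` whose values satisfy a polynomial equation is constant. -/
lemma eq_const_of_polynomial {F : ℍ → ℂ} (hF : Continuous F) {p : Polynomial ℂ} (hp : p ≠ 0)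
    (h : ∀ z, p.eval (F z) = 0) (z w : ℍ) : F z = F w := by
  have hfin : (Set.range F).Finite :=
    (p.roots.toFinset.finite_toSet).subset (by
      rintro _ ⟨z, rfl⟩
      simpa [hp] using h z)
  have hpre : (Set.range F).Subsingleton :=
    hfin.countable.isTotallyDisconnected _ subset_rfl (isPreconnected_range hF)
  exact hpre ⟨z, rfl⟩ ⟨w, rfl⟩

/-- Forms of weight `0` are constant. -/
theorem IsForm.const_of_weight_zero {Γ : Subgroup SL(2, ℝ)} (hΓ : IsFuchsianFirstKind Γ)
    {F : ℍ → ℂ} (hF : IsForm Γ 0 F) (z w : ℍ) : F z = F w := by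
  obtain ⟨C, hC⟩ := hΓ.exists_linear_relation
  -- The `C + 1` powers `1, F, …, F^C` all have weight `0`, one more than the bound `C` allows for
  -- independent forms.
  obtain ⟨c, hc0, hc⟩ := hC 0 (Fin (C + 1)) (fun i => F ^ (i : ℕ))
    (fun i => by simpa using hF.pow i) (by simp)
  refine eq_const_of_polynomial hF.mdiff.continuous
    (p := ∑ i : Fin (C + 1), Polynomial.monomial (i : ℕ) (c i)) ?_ ?_ z w
  · obtain ⟨i, hi⟩ := Function.ne_iff.mp hc0
    intro h
    have := congrArg (fun p : Polynomial ℂ => p.coeff i) h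
    simp [Polynomial.coeff_monomial, Fin.val_inj] at this
    exact hi this
  · intro z
    have := congrFun hc z
    simpa [Polynomial.eval_finsetSum] using this

/-! ### Forms with vanishing covariant `B` -/

lemma isPreconnected_upperHalfPlaneSet : IsPreconnected {z : ℂ | 0 < z.im} :=
  (convex_halfSpace_im_gt 0).isPreconnected

/-- The solutions of `k g g'' = (k+1) g'²` are constants and functions `C (τ + b)^(-k)`. -/
lemma const_or_first_order_of_formB_eq_zero {k : ℤ} (hk : 0 < k) {g : ℂ → ℂ}
    (hg : DifferentiableOn ℂ g {z : ℂ | 0 < z.im})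
    (hB : ∀ z : ℂ, 0 < z.im → formB k (jet g z) = 0) :
    (∀ z w : ℂ, 0 < z.im → 0 < w.im → g z = g w) ∨
      ∃ b : ℂ, (∀ z : ℂ, 0 < z.im → (z + b) * deriv g z + k * g z = 0) ∧
        ∃ z : ℂ, 0 < z.im ∧ g z ≠ 0 ∧ z + b ≠ 0 := by
  have hU := isOpen_upperHalfPlaneSet
  have hD : ∀ z : ℂ, 0 < z.im → HasDerivAt g (deriv g z) z := fun z hz =>
    (hg.differentiableAt (hU.mem_nhds hz)).hasDerivAt
  have hD2 : ∀ z : ℂ, 0 < z.im → HasDerivAt (deriv g) (iteratedDeriv 2 g z) z := fun z hz => by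
    simpa using hasDerivAt_iteratedDeriv hU hg 1 hz
  by_cases h : ∀ z : ℂ, 0 < z.im → deriv g z = 0
  · left
    intro z w hz hw
    exact hU.is_const_of_deriv_eq_zero isPreconnected_upperHalfPlaneSet hg (fun x hx => h x hx)
      hz hw
  · right
    push Not at h
    obtain ⟨z₀, hz₀, hd₀⟩ := h
    have hkC : (k : ℂ) ≠ 0 := by exact_mod_cast hk.ne'
    have hB' : ∀ z : ℂ, 0 < z.im → k * g z * iteratedDeriv 2 g z = (k + 1) * deriv g z ^ 2 := by
      intro z hz
      have := hB z hz
      simp only [formB, jet] at this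
      simpa [sub_eq_zero] using this
    -- At a zero of `g` the equation would force `(k+1) g'² = 0`.
    have hg₀ : g z₀ ≠ 0 := by
      intro h0
      have h1 := hB' z₀ hz₀
      have h2 : (k : ℂ) + 1 ≠ 0 := by exact_mod_cast (by omega : k + 1 ≠ 0)
      rw [h0, mul_zero, zero_mul] at h1
      exact mul_ne_zero h2 (pow_ne_zero 2 hd₀) h1.symm
    obtain ⟨ε, hε, hball⟩ : ∃ ε > 0, ∀ z ∈ Metric.ball z₀ ε, 0 < z.im ∧ deriv g z ≠ 0 := by
      have h1 : ∀ᶠ z in 𝓝 z₀, 0 < z.im ∧ deriv g z ≠ 0 :=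
        (hU.eventually_mem hz₀).and ((hD2 z₀ hz₀).continuousAt.eventually_ne hd₀)
      exact Metric.eventually_nhds_iff_ball.mp h1
    -- The derivative is `1 - g g''/g'² + 1/k = 1 - (k+1)/k + 1/k = 0`. Solving for `g/g'` gives the
    -- first-order equation, and its constant `b`.
    have hconst : ∀ z ∈ Metric.ball z₀ ε, g z / deriv g z + z / k = g z₀ / deriv g z₀ + z₀ / k := by
      have hder : ∀ z ∈ Metric.ball z₀ ε, HasDerivAt (fun z => g z / deriv g z + z / k) 0 z := by
        intro z hz
        obtain ⟨hz1, hz2⟩ := hball z hz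
        convert! ((hD z hz1).div (hD2 z hz1) hz2).add ((hasDerivAt_id z).div_const (k : ℂ)) using 1
        field_simp
        linear_combination hB' z hz1
      intro z hz
      exact Metric.isOpen_ball.is_const_of_deriv_eq_zero (convex_ball _ _).isPreconnected
        (fun x hx => (hder x hx).differentiableAt.differentiableWithinAt)
        (fun x hx => (hder x hx).deriv) hz (Metric.mem_ball_self hε)
    refine ⟨-(k * (g z₀ / deriv g z₀) + z₀), ?_, z₀, hz₀, hg₀, ?_⟩
    -- The identity theorem spreads the equation from the ball, where `g' ≠ 0`, to the half-plane.
    · have hA : AnalyticOnNhd ℂ (fun z => (z + -(k * (g z₀ / deriv g z₀) + z₀)) * deriv g z + k * g z)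
          {z : ℂ | 0 < z.im} := by
        refine DifferentiableOn.analyticOnNhd (fun z hz => ?_) hU
        exact (((differentiableAt_id.add_const _).mul (hD2 z hz).differentiableAt).add
          ((hD z hz).differentiableAt.const_mul _)).differentiableWithinAt
      have := hA.eqOn_zero_of_preconnected_of_eventuallyEq_zero isPreconnected_upperHalfPlaneSet
        hz₀ ?_
      · exact fun z hz => this hz
      · filter_upwards [Metric.ball_mem_nhds z₀ hε] with z hz
        obtain ⟨hz1, hz2⟩ := hball z hz
        have h1 := hconst z hz
        have h2 : z + -(k * (g z₀ / deriv g z₀) + z₀) = - (k * (g z / deriv g z)) := by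
          have h3 : k * (g z / deriv g z + z / k) = k * (g z₀ / deriv g z₀ + z₀ / k) := by rw [h1]
          rw [mul_add, mul_add, mul_div_cancel₀ _ hkC, mul_div_cancel₀ _ hkC] at h3
          linear_combination h3
        rw [h2]
        field_simp
        simp
    · have : z₀ + -(k * (g z₀ / deriv g z₀) + z₀) = -(k * (g z₀ / deriv g z₀)) := by ring
      rw [this]
      exact neg_ne_zero.mpr (mul_ne_zero hkC (div_ne_zero hg₀ hd₀))

/-- If `n`-th powers of an affine function have a real period, then the function is constant. -/
lemma eq_zero_of_periodic_linear_pow {α β : ℂ} {n : ℕ} (hn : n ≠ 0) {h : ℝ} (hh : 0 < h)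
    (hper : ∀ z : ℍ, (α * (z + h) + β) ^ n = (α * z + β) ^ n) : α = 0 := by
  by_contra hα
  -- Equal `n`-th powers have equal absolute values, so the affine function stays bounded along `I +
  -- mh`, which is impossible when `α ≠ 0`.
  have hall : ∀ m : ℕ, ‖α * (UpperHalfPlane.I + m * h) + β‖ = ‖α * UpperHalfPlane.I + β‖ := by
    intro m
    induction m with
    | zero => simp
    | succ m ih =>
      rw [← ih]
      have h1 := congrArg norm (hper (((m : ℝ) * h) +ᵥ UpperHalfPlane.I))
      rw [norm_pow, norm_pow, pow_left_inj₀ (norm_nonneg _) (norm_nonneg _) hn] at h1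
      rw [coe_vadd] at h1
      push_cast at h1 ⊢
      convert! h1 using 3 <;> ring
  obtain ⟨m, hm⟩ := exists_nat_gt (2 * ‖α * UpperHalfPlane.I + β‖ / (‖α‖ * h))
  have hα' : 0 < ‖α‖ := norm_pos_iff.mpr hα
  rw [div_lt_iff₀ (by positivity)] at hm
  have h1 : ‖α * (m * h)‖ ≤ 2 * ‖α * UpperHalfPlane.I + β‖ := by
    calc ‖α * (m * h)‖ = ‖(α * (UpperHalfPlane.I + m * h) + β) - (α * UpperHalfPlane.I + β)‖ := by
          congr 1; ring
      _ ≤ _ := norm_sub_le _ _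
      _ = 2 * ‖α * UpperHalfPlane.I + β‖ := by rw [hall m]; ring
  have h2 : ‖α * ((m : ℂ) * h)‖ = m * (‖α‖ * h) := by
    simp [abs_of_pos hh]; ring
  linarith

/-- A form for which `B` vanishes identically is constant. -/
theorem IsForm.const_of_formB_eq_zero {Γ : Subgroup SL(2, ℝ)} (hΓ : IsFuchsianFirstKind Γ)
    {k : ℤ} {f : ℍ → ℂ} (hf : IsForm Γ k f)
    (hB : ∀ z : ℍ, formB k (jet (f ∘ ofComplex) z) = 0) (z w : ℍ) : f z = f w := by
  rcases lt_trichotomy k 0 with hk | rfl | hk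
  · rw [hf.eq_zero_of_neg hΓ hk]; rfl
  · exact hf.const_of_weight_zero hΓ z w
  have hg := UpperHalfPlane.mdifferentiable_iff.mp hf.mdiff
  rcases const_or_first_order_of_formB_eq_zero hk hg (fun z hz => hB ⟨z, hz⟩) with
    h | ⟨b, hb, z₀, hz₀, hg₀, hz₀b⟩
  · simpa using h z w z.im_pos w.im_pos
  exfalso
  obtain ⟨n, rfl⟩ := Int.eq_ofNat_of_zero_le hk.le
  have hn : n ≠ 0 := by rintro rfl; simp at hk
  obtain ⟨c, hc0, hc⟩ : ∃ c : ℂ, c ≠ 0 ∧ ∀ z : ℍ, f z * (z + b) ^ n = c := by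
    refine ⟨_, mul_ne_zero hg₀ (pow_ne_zero n hz₀b), fun z => ?_⟩
    have hder : ∀ z : ℂ, 0 < z.im →
        HasDerivAt (fun z => (f ∘ ofComplex) z * (z + b) ^ n) 0 z := by
      intro z hz
      have h1 := (hg.differentiableAt (isOpen_upperHalfPlaneSet.mem_nhds hz)).hasDerivAt
      convert! h1.mul (((hasDerivAt_id z).add_const b).pow n) using 1
      obtain ⟨m, rfl⟩ := Nat.exists_eq_succ_of_ne_zero hn
      have := hb z hz
      simp only [id, Nat.succ_eq_add_one, Nat.add_sub_cancel, pow_succ, Pi.pow_apply]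
      push_cast at this ⊢
      linear_combination (-(z + b) ^ m) * this
    have := isOpen_upperHalfPlaneSet.is_const_of_deriv_eq_zero isPreconnected_upperHalfPlaneSet
      (fun x hx => (hder x hx).differentiableAt.differentiableWithinAt)
      (fun x hx => (hder x hx).deriv) z.im_pos hz₀
    simpa using this
  have hne : ∀ z : ℍ, f z ≠ 0 := fun z h => hc0 (by rw [← hc z, h, zero_mul])
  have hH : ∀ z : ℍ, ((z : ℂ) + b) ^ n = c / f z := fun z => by
    rw [eq_div_iff (hne z), mul_comm, hc]
  -- As `c / f`, the polynomial `(z+b)^n` transforms with weight `-n`.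
  have hform : ∀ γ ∈ Γ, (fun z : ℍ => ((z : ℂ) + b) ^ n) ∣[(-n : ℤ)] mapGL ℝ γ =
      fun z : ℍ => ((z : ℂ) + b) ^ n := by
    intro γ hγ
    ext z
    have h1 := congrFun (hf.slash_eq γ hγ) z
    have hd : denom (mapGL ℝ γ) z ^ (n : ℤ) ≠ 0 := zpow_ne_zero _ (denom_ne_zero _ z)
    rw [slash_mapGL_apply] at h1 ⊢
    rw [hH, hH, ← h1, neg_neg, zpow_neg]
    have := hne (γ • z)
    field_simp
  have hHform : IsForm Γ (-n : ℤ) (fun z : ℍ => ((z : ℂ) + b) ^ n) := by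
    refine ⟨hform, ?_, fun σ hσ => ?_⟩
    · rw [UpperHalfPlane.mdifferentiable_iff]
      refine DifferentiableOn.congr (f := fun z => (z + b) ^ n) (by fun_prop) fun z hz => ?_
      simp [ofComplex_apply_of_im_pos hz]
    · obtain ⟨h, hh, hper⟩ := exists_period_at_cusp hσ
      -- Slashing by `σ` turns `(z+b)^n` into the `n`-th power of another affine function. Its
      -- period at the cusp makes it constant, hence bounded.
      have hlin : (fun z : ℍ => ((z : ℂ) + b) ^ n) ∣[(-n : ℤ)] mapGL ℝ σ =
          fun z : ℍ => ((σ 0 0 + b * σ 1 0) * (z : ℂ) + (σ 0 1 + b * σ 1 1)) ^ n := by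
        ext z
        have hd := denom_ne_zero (mapGL ℝ σ) z
        rw [slash_mapGL_apply, neg_neg, zpow_natCast, ← mul_pow, coe_specialLinearGroup_apply]
        have e : denom (mapGL ℝ σ) z = (σ 1 0 : ℂ) * z + σ 1 1 := by simp [denom]
        rw [e] at hd ⊢
        congr 1
        simp only [Algebra.algebraMap_self, RingHom.id_apply]
        rw [add_mul, div_mul_cancel₀ _ hd]
        ring
      have hp := hper _ _ hform
      rw [hlin] at hp ⊢
      have hα := eq_zero_of_periodic_linear_pow hn hh fun z => by
        have h1 := hp z
        have h2 : 0 < ((z : ℂ) + h).im := by simpa using z.im_pos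
        simpa [ofComplex_apply_of_im_pos h2] using h1
      rw [hα]
      simp only [zero_mul, zero_add]
      exact Filter.const_boundedAtFilter _ _
  have h0 := hHform.eq_zero_of_neg hΓ (by omega)
  have h1 := congrFun h0 z
  rw [hH] at h1
  exact div_ne_zero hc0 (hne z) h1

/-! ### Algebraic relations between `P_k` and `Q_k` -/

section Relations

variable {k : ℤ} {f : ℍ → ℂ}

lemma mdifferentiable_clearedODE (hf : MDiff f) (F : MvPolynomial (Fin 2) ℂ) :
    MDiff (fun z : ℍ => clearedODE k F (jet (f ∘ ofComplex) z)) := by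
  obtain ⟨hB, hA, hD⟩ := covariants_mem (k := k) holomorphicSubalgebra (mdifferentiable_jet hf)
  have h0 : (fun z : ℍ => jet (f ∘ ofComplex) z 0) ∈ holomorphicSubalgebra :=
    mdifferentiable_jet hf 0
  let S := holomorphicSubalgebra
  have : (∑ m ∈ F.support, (algebraMap ℂ (ℍ → ℂ) (F.coeff m)) *
      ((fun z : ℍ => formA k (jet (f ∘ ofComplex) z)) ^ 2) ^ m 0 *
      ((fun z : ℍ => jet (f ∘ ofComplex) z 0) ^ 2 *
        fun z : ℍ => formD k (jet (f ∘ ofComplex) z)) ^ m 1 *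
      (fun z : ℍ => formB k (jet (f ∘ ofComplex) z)) ^
        (3 * (F.degreeOf 0 - m 0) + 2 * (F.degreeOf 1 - m 1))) ∈ S :=
    S.sum_mem fun m _ => S.mul_mem (S.mul_mem (S.mul_mem (S.algebraMap_mem _)
      (S.pow_mem (S.pow_mem hA 2) _)) (S.pow_mem (S.mul_mem (S.pow_mem h0 2) hD) _))
      (S.pow_mem hB _)
  convert! this using 1
  ext z
  simp [clearedODE, Finset.sum_apply]

/-- The polynomial relations between `P_k(f)` and `Q_k(f)`. -/
noncomputable def relationIdeal (k : ℤ) (f : ℍ → ℂ) : Ideal (MvPolynomial (Fin 2) ℂ) where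
  carrier := {F | ∀ z : ℍ, formB k (jet (f ∘ ofComplex) z) ≠ 0 →
    MvPolynomial.eval ![invP k (jet (f ∘ ofComplex) z), invQ k (jet (f ∘ ofComplex) z)] F = 0}
  add_mem' hF hG z hz := by rw [map_add, hF z hz, hG z hz, add_zero]
  zero_mem' z hz := map_zero _
  smul_mem' F G hG z hz := by rw [smul_eq_mul, map_mul, hG z hz, mul_zero]

lemma mdifferentiable_formB (hf : MDiff f) :
    MDiff (fun z : ℍ => formB k (jet (f ∘ ofComplex) z)) :=
  (covariants_mem (k := k) holomorphicSubalgebra (mdifferentiable_jet hf)).1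

/-- A holomorphic function that vanishes wherever `B` does not is zero. -/
lemma eq_zero_of_eq_zero_off_formB (hf : MDiff f) {z₀ : ℍ}
    (hz₀ : formB k (jet (f ∘ ofComplex) z₀) ≠ 0) {G : ℍ → ℂ} (hG : MDiff G)
    (h : ∀ z : ℍ, formB k (jet (f ∘ ofComplex) z) ≠ 0 → G z = 0) : G = 0 := by
  have h1 : (fun z : ℍ => formB k (jet (f ∘ ofComplex) z)) * G = 0 := by
    ext z
    by_cases hz : formB k (jet (f ∘ ofComplex) z) = 0
    · simp [hz]
    · simp [h z hz]
  rcases (UpperHalfPlane.mul_eq_zero_iff (mdifferentiable_formB hf) hG).mp h1 with h2 | h2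
  · exact absurd (congrFun h2 z₀) hz₀
  · exact h2

/-- Clearing denominators turns a relation off the zeros of `B` into an identity of holomorphic
functions on all of `ℍ`. -/
lemma mem_relationIdeal_iff (hf : MDiff f) {z₀ : ℍ}
    (hz₀ : formB k (jet (f ∘ ofComplex) z₀) ≠ 0) {F : MvPolynomial (Fin 2) ℂ} :
    F ∈ relationIdeal k f ↔
      (fun z : ℍ => clearedODE k F (jet (f ∘ ofComplex) z)) = 0 := by
  refine ⟨fun h => eq_zero_of_eq_zero_off_formB hf hz₀ (mdifferentiable_clearedODE hf F)
    fun z hz => ?_, fun h z hz => ?_⟩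
  · rw [clearedODE_eq k F _ hz, h z hz, mul_zero]
  · have := congrFun h z
    rw [clearedODE_eq k F _ hz] at this
    exact (mul_eq_zero.mp this).resolve_left (pow_ne_zero _ hz)

/-- Holomorphic functions on `ℍ` have no zero divisors. -/
lemma relationIdeal_isPrime (hf : MDiff f) {z₀ : ℍ}
    (hz₀ : formB k (jet (f ∘ ofComplex) z₀) ≠ 0) : (relationIdeal k f).IsPrime := by
  refine ⟨fun h => ?_, fun {F G} hFG => ?_⟩
  · have : (1 : MvPolynomial (Fin 2) ℂ) ∈ relationIdeal k f := h ▸ Submodule.mem_top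
    simpa using this z₀ hz₀
  · rw [mem_relationIdeal_iff hf hz₀, mem_relationIdeal_iff hf hz₀]
    rw [← UpperHalfPlane.mul_eq_zero_iff (mdifferentiable_clearedODE hf F)
      (mdifferentiable_clearedODE hf G)]
    refine eq_zero_of_eq_zero_off_formB hf hz₀
      ((mdifferentiable_clearedODE hf F).mul (mdifferentiable_clearedODE hf G)) fun z hz => ?_
    have h1 := hFG z hz
    rw [map_mul] at h1
    rw [Pi.mul_apply, clearedODE_eq k F _ hz, clearedODE_eq k G _ hz]
    linear_combination (formB k (jet (f ∘ ofComplex) z) ^ (3 * F.degreeOf 0 + 2 * F.degreeOf 1) *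
      formB k (jet (f ∘ ofComplex) z) ^ (3 * G.degreeOf 0 + 2 * G.degreeOf 1)) * h1

/-- `P_k(f)` and `Q_k(f)` are algebraically dependent. -/
lemma relationIdeal_ne_bot {Γ : Subgroup SL(2, ℝ)} (hΓ : IsFuchsianFirstKind Γ) (hk : 0 ≤ k)
    (hf : IsForm Γ k f) : relationIdeal k f ≠ ⊥ := by
  obtain ⟨n, rfl⟩ := Int.eq_ofNat_of_zero_le hk
  obtain ⟨C, hC⟩ := hΓ.exists_linear_relation
  obtain ⟨hB, hA, hD⟩ := hf.covariants
  set A : ℍ → ℂ := fun z : ℍ => formA n (jet (f ∘ ofComplex) z) with hAdef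
  set B : ℍ → ℂ := fun z : ℍ => formB n (jet (f ∘ ofComplex) z) with hBdef
  set D : ℍ → ℂ := fun z : ℍ => formD n (jet (f ∘ ofComplex) z) with hDdef
  -- Chosen so that `C (N(5n+10) + 1) ≤ N² + N < (N+1)²`.
  set N := C * (5 * n + 10) + C with hN
  -- These are `B^(5N) P^i Q^j`; the powers of `B` make all the weights equal to `N(10n+20)`.
  let F : Fin (N + 1) × Fin (N + 1) → ℍ → ℂ := fun p =>
    A ^ (2 * (p.1 : ℕ)) * B ^ (3 * (N - p.1)) * ((f ^ 2 * D) ^ (p.2 : ℕ) * B ^ (2 * (N - p.2)))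
  have hF : ∀ p, IsForm Γ (2 * ((N * (5 * n + 10) : ℕ) : ℤ)) (F p) := by
    intro p
    have h := ((hA.pow (2 * (p.1 : ℕ))).mul (hB.pow (3 * (N - p.1)))).mul
      ((((hf.pow 2).mul hD).pow (p.2 : ℕ)).mul (hB.pow (2 * (N - p.2))))
    convert! h using 1
    have h1 : (p.1 : ℕ) ≤ N := Nat.lt_succ_iff.mp p.1.2
    have h2 : (p.2 : ℕ) ≤ N := Nat.lt_succ_iff.mp p.2.2
    push_cast [Nat.cast_sub h1, Nat.cast_sub h2]
    ring
  obtain ⟨c, hc0, hc⟩ := hC _ _ F hF (by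
    simp only [Fintype.card_prod, Fintype.card_fin]
    nlinarith)
  let e : Fin (N + 1) × Fin (N + 1) → Fin 2 →₀ ℕ := fun p =>
    Finsupp.equivFunOnFinite.symm ![(p.1 : ℕ), (p.2 : ℕ)]
  have he : Function.Injective e := by
    intro p q hpq
    have h := Finsupp.equivFunOnFinite.symm.injective hpq
    ext
    · simpa using congrFun h 0
    · simpa using congrFun h 1
  rw [Submodule.ne_bot_iff]
  refine ⟨∑ p, MvPolynomial.monomial (e p) (c p), fun z hz => ?_, ?_⟩
  · have h1 := congrFun hc z
    have hBz : B z ≠ 0 := hz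
    rw [Finset.sum_apply] at h1
    have h2 : B z ^ (5 * N) * MvPolynomial.eval ![invP n (jet (f ∘ ofComplex) z),
        invQ n (jet (f ∘ ofComplex) z)] (∑ p, MvPolynomial.monomial (e p) (c p)) = 0 := by
      refine Eq.trans ?_ h1
      rw [map_sum, Finset.mul_sum]
      refine Finset.sum_congr rfl fun p _ => ?_
      rw [MvPolynomial.eval_monomial]
      simp only [Finsupp.prod_fintype _ _ (fun _ => pow_zero _), Fin.prod_univ_two, e,
        Finsupp.equivFunOnFinite_symm_apply_apply, Matrix.cons_val_zero, Matrix.cons_val_one]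
      have hP : invP n (jet (f ∘ ofComplex) z) = A z ^ 2 / B z ^ 3 := rfl
      have hQ : invQ n (jet (f ∘ ofComplex) z) = f z ^ 2 * D z / B z ^ 2 := by
        simp [invQ, jet, hBdef, hDdef]
      rw [hP, hQ]
      obtain ⟨a, ha⟩ := Nat.exists_eq_add_of_le (Nat.lt_succ_iff.mp p.1.2)
      obtain ⟨b, hb⟩ := Nat.exists_eq_add_of_le (Nat.lt_succ_iff.mp p.2.2)
      have e1 : B z ^ (5 * N) = (B z ^ 3) ^ (p.1 : ℕ) * B z ^ (3 * a) *
          ((B z ^ 2) ^ (p.2 : ℕ) * B z ^ (2 * b)) := by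
        rw [← pow_mul, ← pow_mul, ← pow_add, ← pow_add, ← pow_add]
        congr 1
        omega
      have e2 : N - (p.1 : ℕ) = a := by omega
      have e3 : N - (p.2 : ℕ) = b := by omega
      simp only [F, Pi.smul_apply, Pi.mul_apply, Pi.pow_apply, smul_eq_mul, e1, e2, e3, div_pow]
      field_simp
      ring
    exact (mul_eq_zero.mp h2).resolve_left (pow_ne_zero _ hBz)
  · obtain ⟨p, hp⟩ := Function.ne_iff.mp hc0
    intro h
    have h1 := congrArg (MvPolynomial.coeff (e p)) h
    simp only [MvPolynomial.coeff_sum, MvPolynomial.coeff_monomial, he.eq_iff,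
      MvPolynomial.coeff_zero] at h1
    simp at h1
    exact hp h1

/-- A polynomial relation not involving `Q_k` forces `P_k` to be constant. -/
lemma exists_invP_eq_const (hf : MDiff f) {z₀ : ℍ}
    (hz₀ : formB k (jet (f ∘ ofComplex) z₀) ≠ 0) {p : MvPolynomial (Fin 2) ℂ} (hp0 : p ≠ 0)
    (hp : p ∈ relationIdeal k f) (hdeg : p.degreeOf 1 = 0) :
    ∃ r : ℂ, ∀ z : ℍ, formB k (jet (f ∘ ofComplex) z) ≠ 0 →
      invP k (jet (f ∘ ofComplex) z) = r := by
  let ψ : Polynomial ℂ →ₐ[ℂ] MvPolynomial (Fin 2) ℂ := Polynomial.aeval (MvPolynomial.X 0)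
  obtain ⟨u, hu⟩ : ∃ u, ψ u = p := by
    refine ⟨MvPolynomial.aeval ![Polynomial.X, 0] p, ?_⟩
    have h1 : (ψ.comp (MvPolynomial.aeval ![Polynomial.X, 0])) p = AlgHom.id ℂ _ p := by
      refine MvPolynomial.hom_congr_vars (f₁ := (ψ.comp _).toRingHom)
        (f₂ := (AlgHom.id ℂ _).toRingHom) ?_ ?_ rfl
      · ext r : 1
        simp [ψ, MvPolynomial.algebraMap_eq]
      · intro i hi _
        fin_cases i
        · simp [ψ]
        · exact absurd hdeg (MvPolynomial.mem_vars_iff_degreeOf_ne_zero.mp hi)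
    simpa using h1
  have hprime := relationIdeal_isPrime hf hz₀
  have hprime' : ((relationIdeal k f).comap ψ).IsPrime := hprime.comap ψ
  have hne : (relationIdeal k f).comap ψ ≠ ⊥ := by
    rw [Submodule.ne_bot_iff]
    refine ⟨u, by rwa [Ideal.mem_comap, hu], ?_⟩
    rintro rfl
    exact hp0 (by rw [← hu, map_zero])
  -- A prime of `ℂ[X]` is linear, and its root is the value of `P_k`.
  obtain ⟨q, hq, hqp⟩ := hprime'.exists_mem_prime_of_ne_bot hne
  have hq1 : q.degree = 1 := IsAlgClosed.degree_eq_one_of_irreducible ℂ hqp.irreducible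
  have hqa := Polynomial.eq_X_add_C_of_degree_eq_one hq1
  have hlc : q.leadingCoeff ≠ 0 := Polynomial.leadingCoeff_ne_zero.mpr hqp.ne_zero
  refine ⟨-q.coeff 0 / q.leadingCoeff, fun z hz => ?_⟩
  have h1 := hq z hz
  rw [hqa] at h1
  simp [ψ] at h1
  rw [eq_div_iff hlc]
  linear_combination h1

/-- The bracket `k f B' - (2k+4) f' B` of the forms `f` and `B` is `A`. -/
lemma hasDerivAt_formB {g : ℂ → ℂ} {U : Set ℂ} (hU : IsOpen U) (hg : DifferentiableOn ℂ g U)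
    {τ : ℂ} (hτ : τ ∈ U) : ∃ b', HasDerivAt (fun τ => formB k (jet g τ)) b' τ ∧
      k * jet g τ 0 * b' = (2 * k + 4) * jet g τ 1 * formB k (jet g τ) + formA k (jet g τ) := by
  have D : ∀ n : ℕ, HasDerivAt (iteratedDeriv n g) (iteratedDeriv (n + 1) g τ) τ :=
    fun n => hasDerivAt_iteratedDeriv hU hg n hτ
  refine ⟨_, (((D 0).const_mul (k : ℂ)).mul (D 2)).sub (((D 1).pow 2).const_mul ((k : ℂ) + 1)), ?_⟩
  simp [formB, formA, jet]
  ring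

/-- The bracket of `f` and `A` brings in `D`: up to the factor `k + 1` it is a combination of `f²D`
and `B²`. -/
lemma hasDerivAt_formA {g : ℂ → ℂ} {U : Set ℂ} (hU : IsOpen U) (hg : DifferentiableOn ℂ g U)
    {τ : ℂ} (hτ : τ ∈ U) : ∃ a', HasDerivAt (fun τ => formA k (jet g τ)) a' τ ∧
      (k + 1) * (k * jet g τ 0 * a' - (3 * k + 6) * jet g τ 1 * formA k (jet g τ)) =
        k ^ 2 * (jet g τ 0 ^ 2 * formD k (jet g τ)) - 6 * (k + 2) ^ 2 * formB k (jet g τ) ^ 2 := by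
  have D : ∀ n : ℕ, HasDerivAt (iteratedDeriv n g) (iteratedDeriv (n + 1) g τ) τ :=
    fun n => hasDerivAt_iteratedDeriv hU hg n hτ
  refine ⟨_, (((((D 0).pow 2).const_mul ((k : ℂ) ^ 2)).mul (D 3)).sub
    ((((D 0).const_mul (3 * (k : ℂ) * (k + 2))).mul (D 1)).mul (D 2))).add
    (((D 1).pow 3).const_mul (2 * ((k : ℂ) + 1) * (k + 2))), ?_⟩
  simp [formB, formA, formD, jet]
  ring

/-- If `P_k` is constant, so is `Q_k`. -/
lemma exists_invQ_eq_const (hk : k ≠ 0) (hf : MDiff f) {z₀ : ℍ}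
    (hz₀ : formB k (jet (f ∘ ofComplex) z₀) ≠ 0) {r : ℂ}
    (hr : ∀ z : ℍ, formB k (jet (f ∘ ofComplex) z) ≠ 0 → invP k (jet (f ∘ ofComplex) z) = r) :
    ∃ q : ℂ, ∀ z : ℍ, formB k (jet (f ∘ ofComplex) z) ≠ 0 →
      invQ k (jet (f ∘ ofComplex) z) = q := by
  have hkC : (k : ℂ) ≠ 0 := by exact_mod_cast hk
  have hg := UpperHalfPlane.mdifferentiable_iff.mp hf
  let S := holomorphicSubalgebra
  obtain ⟨hB, hA, hD⟩ := covariants_mem (k := k) S (mdifferentiable_jet hf)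
  have h0 : (fun z : ℍ => jet (f ∘ ofComplex) z 0) ∈ S := mdifferentiable_jet hf 0
  have hc : ∀ c : ℂ, (fun _ : ℍ => c) ∈ S := fun c => S.algebraMap_mem c
  set y : ℍ → Fin 5 → ℂ := fun z => jet (f ∘ ofComplex) z with hy
  have hAB : ∀ z, formA k (y z) ^ 2 - r * formB k (y z) ^ 3 = 0 := by
    refine congrFun (eq_zero_of_eq_zero_off_formB hf hz₀
      (S.sub_mem (S.pow_mem hA 2) (S.mul_mem (hc r) (S.pow_mem hB 3))) fun z hz => ?_)
    have := hr z hz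
    rw [invP, div_eq_iff (pow_ne_zero 3 hz)] at this
    change formA k (y z) ^ 2 - r * formB k (y z) ^ 3 = 0
    rw [this]; ring
  -- the function `T` is `(k + 1)` times the bracket of `f` and `A`
  let T : ℍ → ℂ := fun z => k ^ 2 * (y z 0 ^ 2 * formD k (y z)) -
    6 * (k + 2) ^ 2 * formB k (y z) ^ 2
  obtain ⟨s, hs⟩ : ∃ s : ℂ, ∀ z, T z = s * formB k (y z) ^ 2 := by
    have hder : ∀ z : ℍ, ∃ a', HasDerivAt (fun τ => formA k (jet (f ∘ ofComplex) τ)) a' z ∧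
        (k + 1) * (k * y z 0 * a' - (3 * k + 6) * y z 1 * formA k (y z)) = T z :=
      fun z => hasDerivAt_formA isOpen_upperHalfPlaneSet hg z.im_pos
    -- Differentiate `A² = r B³`, multiply by `(k+1) k f` and insert both brackets. The terms in
    -- `f'` cancel by the equation itself, leaving a product with the factor `A`.
    have hmul : (fun z => formA k (y z)) *
        (fun z => 2 * T z - 3 * r * (k + 1) * formB k (y z) ^ 2) = 0 := by
      ext z
      obtain ⟨a', ha', hT⟩ := hder z
      obtain ⟨b', hb', hA'⟩ := hasDerivAt_formB (k := k) isOpen_upperHalfPlaneSet hg z.im_pos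
      have h1 : HasDerivAt (fun τ => formA k (jet (f ∘ ofComplex) τ) ^ 2 -
          r * formB k (jet (f ∘ ofComplex) τ) ^ 3) 0 z := by
        refine (hasDerivAt_const (z : ℂ) (0 : ℂ)).congr_of_eventuallyEq ?_
        filter_upwards [isOpen_upperHalfPlaneSet.mem_nhds z.im_pos] with τ hτ
        exact hAB ⟨τ, hτ⟩
      have h2 := h1.unique ((ha'.pow 2).sub ((hb'.pow 3).const_mul r))
      have h3 := hAB z
      change _ = (2 * k + 4) * y z 1 * formB k (y z) + formA k (y z) at hA'
      change k * y z 0 * b' = _ at hA'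
      simp only [Nat.cast_ofNat, Nat.add_one_sub_one, pow_one] at h2
      change 0 = 2 * formA k (y z) * a' - r * (3 * formB k (y z) ^ 2 * b') at h2
      simp only [Pi.mul_apply, Pi.zero_apply]
      rw [← hT]
      linear_combination (-2 * (k + 1) * (3 * k + 6) * y z 1) * h3 +
        (-(k + 1) * k * y z 0) * h2 + (3 * r * (k + 1) * formB k (y z) ^ 2) * hA'
    have hTS : T ∈ S := S.sub_mem (S.mul_mem (hc _) (S.mul_mem (S.pow_mem h0 2) hD))
      (S.mul_mem (hc _) (S.pow_mem hB 2))
    rcases (UpperHalfPlane.mul_eq_zero_iff hA (S.sub_mem (S.mul_mem (hc 2) hTS)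
      (S.mul_mem (hc (3 * r * (k + 1))) (S.pow_mem hB 2)))).mp hmul with h | h
    -- If `A ≡ 0`, its bracket with `f`, and so `T`, vanishes.
    · refine ⟨0, fun z => ?_⟩
      obtain ⟨a', ha', hT⟩ := hder z
      have h1 : HasDerivAt (fun τ => formA k (jet (f ∘ ofComplex) τ)) 0 z := by
        refine (hasDerivAt_const (z : ℂ) (0 : ℂ)).congr_of_eventuallyEq ?_
        filter_upwards [isOpen_upperHalfPlaneSet.mem_nhds z.im_pos] with τ hτ
        exact congrFun h ⟨τ, hτ⟩
      have h2 : formA k (y z) = 0 := congrFun h z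
      rw [← hT, ha'.unique h1, h2]
      ring
    · refine ⟨3 * r * (k + 1) / 2, fun z => ?_⟩
      have h1 : 2 * T z - 3 * r * (k + 1) * formB k (y z) ^ 2 = 0 := congrFun h z
      linear_combination h1 / 2
  refine ⟨(s + 6 * (k + 2) ^ 2) / k ^ 2, fun z hz => ?_⟩
  have h1 : k ^ 2 * (y z 0 ^ 2 * formD k (y z)) - 6 * (k + 2) ^ 2 * formB k (y z) ^ 2 =
    s * formB k (y z) ^ 2 := hs z
  rw [invQ, div_eq_div_iff (pow_ne_zero 2 hz) (pow_ne_zero 2 hkC)]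
  linear_combination h1

end Relations

/-! ### The irreducible relation and the theorem -/

lemma irreducible_X_sub_C (q : ℂ) :
    Irreducible (MvPolynomial.X 1 - MvPolynomial.C q : MvPolynomial (Fin 2) ℂ) ∧
      0 < (MvPolynomial.X 1 - MvPolynomial.C q : MvPolynomial (Fin 2) ℂ).degreeOf 1 := by
  have h1 : (MvPolynomial.X 1 - MvPolynomial.C q : MvPolynomial (Fin 2) ℂ).coeff
      (Finsupp.single 1 1) = 1 := by
    have h : (0 : Fin 2 →₀ ℕ) ≠ Finsupp.single 1 1 := by
      simp [eq_comm (a := (0 : Fin 2 →₀ ℕ))]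
    simp [MvPolynomial.coeff_X, MvPolynomial.coeff_C, h]
  have h2 : Finsupp.single 1 1 ∈
      (MvPolynomial.X 1 - MvPolynomial.C q : MvPolynomial (Fin 2) ℂ).support := by
    simp [MvPolynomial.mem_support_iff, h1]
  refine ⟨MvPolynomial.irreducible_of_totalDegree_eq_one (le_antisymm ?_ ?_) fun x hx => ?_, ?_⟩
  · refine (MvPolynomial.totalDegree_sub_C_le _ _).trans ?_
    simp
  · simpa using MvPolynomial.le_totalDegree h2
  · have := hx (Finsupp.single 1 1)
    rw [h1] at this
    exact isUnit_of_dvd_one this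
  · simpa [Nat.succ_le_iff] using MvPolynomial.monomial_le_degreeOf 1 h2

/-- The irreducible relation between `P_k(f)` and `Q_k(f)`. -/
lemma exists_irreducible_relation {Γ : Subgroup SL(2, ℝ)} (hΓ : IsFuchsianFirstKind Γ) {k : ℤ}
    (hk : 0 < k) {f : ℍ → ℂ} (hf : IsForm Γ k f) {z₀ : ℍ}
    (hz₀ : formB k (jet (f ∘ ofComplex) z₀) ≠ 0) :
    ∃ F ∈ relationIdeal k f, Irreducible F ∧ 0 < F.degreeOf 1 := by
  obtain ⟨p, hp, hpp⟩ := (relationIdeal_isPrime hf.mdiff hz₀).exists_mem_prime_of_ne_bot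
    (relationIdeal_ne_bot hΓ hk.le hf)
  -- A prime relation without `Y` makes `P_k`, hence `Q_k`, constant; it is then exchanged for `Y -
  -- q`.
  by_cases hdeg : p.degreeOf 1 = 0
  · obtain ⟨r, hr⟩ := exists_invP_eq_const hf.mdiff hz₀ hpp.ne_zero hp hdeg
    obtain ⟨q, hq⟩ := exists_invQ_eq_const hk.ne' hf.mdiff hz₀ hr
    refine ⟨MvPolynomial.X 1 - MvPolynomial.C q, fun z hz => ?_, irreducible_X_sub_C q⟩
    simp [hq z hz]
  · exact ⟨p, hp, hpp.irreducible, Nat.pos_of_ne_zero hdeg⟩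

/-- All derivatives of a constant function on the upper half-plane vanish. -/
lemma jet_eq_zero_of_const {f : ℍ → ℂ} (hf : ∀ z w : ℍ, f z = f w) (z : ℍ) {i : Fin 5}
    (hi : i ≠ 0) : jet (f ∘ ofComplex) z i = 0 := by
  have h : f ∘ ofComplex = fun _ => f z := by
    ext τ
    exact hf _ _
  have hi' : (i : ℕ) ≠ 0 := fun h => hi (Fin.ext h)
  simp [jet, h, iteratedDeriv_const, hi']

lemma forms_eq_zero_of_const {f : ℍ → ℂ} (hf : ∀ z w : ℍ, f z = f w) (k : ℤ) (z : ℍ) :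
    formB k (jet (f ∘ ofComplex) z) = 0 ∧ formD k (jet (f ∘ ofComplex) z) = 0 := by
  have h1 := jet_eq_zero_of_const hf z (i := 1) (by decide)
  have h2 := jet_eq_zero_of_const hf z (i := 2) (by decide)
  have h3 := jet_eq_zero_of_const hf z (i := 3) (by decide)
  have h4 := jet_eq_zero_of_const hf z (i := 4) (by decide)
  constructor
  · simp [formB, h1, h2]
  · simp [formD, h1, h2, h3, h4]

lemma clearedODE_X_one (k : ℤ) (y : Fin 5 → ℂ) :
    clearedODE k (MvPolynomial.X 1) y = y 0 ^ 2 * formD k y := by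
  have h : (MvPolynomial.X 1 : MvPolynomial (Fin 2) ℂ).support = {Finsupp.single 1 1} :=
    MvPolynomial.support_X
  rw [clearedODE, h, Finset.sum_singleton]
  simp [MvPolynomial.degreeOf_X]

theorem mainTheorem2 (Γ : Subgroup SL(2, ℝ)) (hΓ : IsFuchsianFirstKind Γ) (k : ℤ)
    (f : ModularForm (asGL Γ) k) :
    IsDifferentialInvariant k (invP k) ∧ IsDifferentialInvariant k (invQ k) ∧
    -- unless `f` is constant, `P_k` and `Q_k` are defined at `f` (the denominator is not `≡ 0`)
    ((∃ z w : ℍ, f z ≠ f w) → ∃ z : ℍ, formB k (jet (f ∘ ofComplex) z) ≠ 0) ∧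
    -- the ODE `𝓕(P_k, Q_k) = 0`, algebraic and really involving the fourth-order invariant
    ∃ F : MvPolynomial (Fin 2) ℂ, Irreducible F ∧ 0 < F.degreeOf 1 ∧
      IsInvariantODE k (clearedODE k F) ∧
      SolvesODE (clearedODE k F) {z : ℂ | 0 < z.im} (f ∘ ofComplex) ∧
      ∀ z : ℍ, formB k (jet (f ∘ ofComplex) z) ≠ 0 →
        MvPolynomial.eval
          ![invP k (jet (f ∘ ofComplex) z), invQ k (jet (f ∘ ofComplex) z)] F = 0 := by
  have hf := f.isForm
  refine ⟨isDifferentialInvariant_invP k, isDifferentialInvariant_invQ k, ?_, ?_⟩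
  · rintro ⟨z, w, hzw⟩
    by_contra! hB
    exact hzw (hf.const_of_formB_eq_zero hΓ hB z w)
  by_cases hB : ∃ z₀ : ℍ, formB k (jet (f ∘ ofComplex) z₀) ≠ 0
  · obtain ⟨z₀, hz₀⟩ := hB
    -- Forms of weight `≤ 0` are constant and have `B ≡ 0`.
    have hk : 0 < k := by
      by_contra! hk
      refine hz₀ (forms_eq_zero_of_const (fun z w => ?_) k z₀).1
      rcases hk.lt_or_eq with hk | rfl
      · rw [hf.eq_zero_of_neg hΓ hk]
        rfl
      · exact hf.const_of_weight_zero hΓ z w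
    obtain ⟨F, hF, hirr, hdeg⟩ := exists_irreducible_relation hΓ hk hf hz₀
    refine ⟨F, hirr, hdeg, isInvariantODE_clearedODE k F, fun τ hτ => ?_, hF⟩
    exact congrFun ((mem_relationIdeal_iff hf.mdiff hz₀).mp hF) ⟨τ, hτ⟩
  · push Not at hB
    have hconst := hf.const_of_formB_eq_zero hΓ hB
    obtain ⟨hirr, hdeg⟩ := irreducible_X_sub_C 0
    rw [map_zero, sub_zero] at hirr hdeg
    -- For constant `f` the choice `𝓕 = Y` works: its cleared equation is `f²D = 0`, and no point
    -- has `B ≠ 0`.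
    refine ⟨MvPolynomial.X 1, hirr, hdeg, isInvariantODE_clearedODE k _, fun τ hτ => ?_,
      fun z hz => absurd (hB z) hz⟩
    have hD : formD k (jet (f ∘ ofComplex) τ) = 0 := (forms_eq_zero_of_const hconst k ⟨τ, hτ⟩).2
    rw [clearedODE_X_one, hD, mul_zero]
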